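/- **Theorem 3.1.** Let $\mathcal X,\mathcal Y$ be real Hilbert spaces, let $K:\mathcal X\to\mathcal Y$ be a continuous linear operator with adjoint $K^*$, and let $F:\mathcal Y\to(-\infty,+\infty]$ and $\bar G,H:\mathcal X\to(-\infty,+\infty]$ be proper, lower semicontinuous and convex. Consider the problem $$\min_{x\in\mathcal X}\;F(Kx)+\bar G(x)+H(x).\tag{1.4}$$ Assume that the infimum in (1.4) is attained and that the qualification condition $$0\in\operatorname{ri}\bigl(\operatorname{dom}\bar G\times\operatorname{dom}F-\{(x,Kx):x\in\operatorname{dom}H\}\bigr)$$ holds, where $\operatorname{dom} f=\{f<+\infty\}$, and $0\in\operatorname{ri}S$ means that $0$ lies in the interior of $S\subseteq\mathcal X\times\mathcal Y$ relative to the affine hull of $S$ and that this affine hull is closed (the latter is automatic in finite dimension). For $t>0$ let $\operatorname{prox}_{tf}(x)=\arg\min_u\{t f(u)+\tfrac12\|x-u\|^2\}$, and let $f^*(y)=\sup_x\{\langle x,y\rangle-f(x)\}$. Let $\sigma,\gamma,\tau>0$, and let $(\alpha_k)_{k\ge1}$, $(\rho_k)_{k\ge1}$ be real sequences. Choose $x^0,x^1,y^0,y^1\in\mathcal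 X$ and $v^0,v^1\in\mathcal Y$ arbitrarily, and for $k\ge1$ let $$\begin{aligned} \xi^k&=x^k+\alpha_k(x^k-x^{k-1}),\quad \eta^k=y^k+\alpha_k(y^k-y^{k-1}),\quad \nu^k=v^k+\alpha_k(v^k-v^{k-1}),\\ \tilde x^{k+1}&=\operatorname{prox}_{\sigma H}(\xi^k-\sigma\eta^k-\sigma K^*\nu^k),\\ \tilde y^{k+1}&=\operatorname{prox}_{\gamma\bar G^*}\bigl(\eta^k+\gamma(2\tilde x^{k+1}-\xi^k)\bigr),\\ \tilde v^{k+1}&=\operatorname{prox}_{\tau F^*}\bigl(\nu^k+\tau K(2\tilde x^{k+1}-\xi^k)\bigr),\\ (x^{k+1},y^{k+1},v^{k+1})&=\rho_k(\tilde x^{k+1},\tilde y^{k+1},\tilde v^{k+1})+(1-\rho_k)(\xi^k,\eta^k,\nu^k). \end{aligned}$$ Suppose that (i) $\sigma\gamma+\sigma\tau\|K\|^2<1$; (ii) $(\alpha_k)_{k\ge1}$ is nondecreasing with $\alpha_1=0$ and $0\le\alpha_k\le\alpha<1$ for all $k\ge1$, and $\rho,\theta,\hat\delta>0$ are such that $$\hat\delta>\frac{\alpha^2(1+\alpha)+\alpha\theta}{1-\alpha^2}\quad\text{and}\quad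 0<\rho\le\rho_k<\frac{\hat\delta-\alpha[\alpha(1+\alpha)+\alpha\hat\delta+\theta]}{\hat\delta[1+\alpha(1+\alpha)+\alpha\hat\delta+\theta]}\quad\text{for all }k\ge1.$$ Then there is a solution $x^\star$ of (1.4) such that $x^k$ converges weakly to $x^\star$; if $\mathcal X$ is finite-dimensional, then $x^k\to x^\star$ in norm. -/

import Mathlib

open Set Filter Topology
open scoped RealInnerProductSpace Pointwise

/-- The class `Γ₀(E)`: proper, lower semicontinuous, convex functions `E → (-∞, +∞]`. -/
structure GammaZero {E : Type*} [NormedAddCommGroup E] [InnerProductSpace ℝ E]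
    (f : E → EReal) : Prop where
  ne_bot : ∀ x, f x ≠ ⊥
  exists_ne_top : ∃ x, f x ≠ ⊤
  lsc : LowerSemicontinuous f
  convex : ∀ (x y : E) (a b : ℝ), 0 < a → 0 < b → a + b = 1 →
    f (a • x + b • y) ≤ (a : EReal) * f x + (b : EReal) * f y

/-- The effective domain of an extended-real-valued function. -/
def effDom {E : Type*} (f : E → EReal) : Set E := {x | f x ≠ ⊤}

/-- The Legendre-Fenchel conjugate `f*(y) = sup_x (⟨x, y⟩ - f x)`. -/
noncomputable def fenchelConj {E : Type*} [NormedAddCommGroup E] [InnerProductSpace ℝ E]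
    (f : E → EReal) (y : E) : EReal :=
  ⨆ x : E, ((⟪x, y⟫ : ℝ) : EReal) - f x

/-- The objective `u ↦ f u + ½ ‖x - u‖²` minimized by the proximity operator at `x`. -/
noncomputable def proxObjective {E : Type*} [NormedAddCommGroup E] [InnerProductSpace ℝ E]
    (f : E → EReal) (x u : E) : EReal :=
  f u + ((‖x - u‖ ^ 2 / 2 : ℝ) : EReal)

/-- The proximity operator `prox_{t f}(x) = argmin_u (t f u + ½ ‖x - u‖²)` with step size `t`.
For `f` in `Γ₀` on a Hilbert space and `t > 0` the minimizer exists and is unique, so the choice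
below is that minimizer. -/
noncomputable def prox {E : Type*} [NormedAddCommGroup E] [InnerProductSpace ℝ E]
    (t : ℝ) (f : E → EReal) (x : E) : E :=
  Classical.epsilon fun p : E =>
    IsMinOn (proxObjective (fun u => (t : EReal) * f u) x) univ p

section PrimalDual

variable {X Y : Type*} [NormedAddCommGroup X] [InnerProductSpace ℝ X]
  [NormedAddCommGroup Y] [InnerProductSpace ℝ Y]

/-- The objective `x ↦ F (K x) + G x + H x`. -/
noncomputable def primalObjective (F : Y → EReal) (G H : X → EReal) (K : X →L[ℝ] Y) (x : X) : EReal :=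
  F (K x) + G x + H x

/-- `x` solves `min F (K x) + G x + H x`. -/
def IsPrimalSolution (F : Y → EReal) (G H : X → EReal) (K : X →L[ℝ] Y) (x : X) : Prop :=
  IsMinOn (primalObjective F G H K) univ x

/-- The set `dom h - D (dom H)` in `X × Y`, where `h (y, v) = G y + F v` and `D x = (x, K x)`. -/
def qualificationSet (F : Y → EReal) (G H : X → EReal) (K : X →L[ℝ] Y) : Set (X × Y) :=
  (effDom G ×ˢ effDom F) - (fun x : X => (x, K x)) '' effDom H

/-- The qualification condition `0 ∈ ri (dom h - D (dom H))`. The relative interior is the interior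
in the affine hull. The affine hull is required to be closed, which is automatic in finite
dimension; in general Hilbert spaces this is the usual strong relative interior. -/
def QualificationCondition (F : Y → EReal) (G H : X → EReal) (K : X →L[ℝ] Y) : Prop :=
  (0 : X × Y) ∈ intrinsicInterior ℝ (qualificationSet F G H K) ∧
    IsClosed (affineSpan ℝ (qualificationSet F G H K) : Set (X × Y))

/-- The sequences `(x, y, v)` are generated by the inertial primal-dual fixed point algorithm with
proximal parameters `σ, γ, τ`, extrapolation parameters `α k` and relaxation parameters `ρ k`
(`k ≥ 1`), from arbitrary starting points with indices `0` and `1`. -/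
def IsIPDFPSequence [CompleteSpace X] [CompleteSpace Y]
    (F : Y → EReal) (G H : X → EReal) (K : X →L[ℝ] Y)
    (σ γ τ : ℝ) (α ρ : ℕ → ℝ) (x y : ℕ → X) (v : ℕ → Y) : Prop :=
  ∀ k : ℕ, 1 ≤ k →
    let ξ : X := x k + α k • (x k - x (k - 1))
    let η : X := y k + α k • (y k - y (k - 1))
    let ν : Y := v k + α k • (v k - v (k - 1))
    let x' : X := prox σ H (ξ - σ • η - σ • (ContinuousLinearMap.adjoint K) ν)
    let y' : X := prox γ (fenchelConj G) (η + γ • ((2 : ℝ) • x' - ξ))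
    let v' : Y := prox τ (fenchelConj F) (ν + τ • K ((2 : ℝ) • x' - ξ))
    x (k + 1) = ρ k • x' + (1 - ρ k) • ξ ∧
    y (k + 1) = ρ k • y' + (1 - ρ k) • η ∧
    v (k + 1) = ρ k • v' + (1 - ρ k) • ν

end PrimalDual

/-!
The algorithm is an inertial Krasnosel'skiĭ–Mann iteration for the operator `pdStep`, which sends
`(ξ, η, ν)` to the three proximal points. Written in terms of subdifferentials, `pdStep` is the
resolvent of a monotone operator with respect to the operator matrix behind `pdForm`
(`hasSubgradient_pdStep`). The step size condition makes `pdForm` an equivalent inner product on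
`X ⊕ X ⊕ Y` (`pdForm_coercive`), for which `pdStep` is therefore firmly nonexpansive
(`pdStep_firmlyNonexpansive`). Its fixed points are the triples `(x, y, v)` with `y ∈ ∂G x`,
`v ∈ ∂F (K x)` and `-y - K* v ∈ ∂H x`, and then `x` is a minimizer by adding up the three
subgradient inequalities. The proximity operators of the conjugates are treated through Moreau's decomposition,
so that biconjugation plays no role.

A fixed point exists by the theorem of Attouch and Brezis
(`IsPrimalSolution.exists_hasSubgradient`).
The perturbed optimal value has the qualification set as its domain. Weak compactness of balls in
`X` shows that this set is a countable union of closed sets on which the value is bounded above.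
Baire's theorem, applied in the closed span of the qualification set, gives an interior point of the
epigraph there, and the Hahn–Banach theorem gives a subgradient of the value at `0`.

For the convergence (`exists_weak_limit_inertial`), fix a fixed point `p`. The parameter conditions
make an energy built from the squared distances to `p` and the squared increments nonincreasing, so
the squared increments are summable and, by the lemma of Alvarez and Attouch, the distance to `p`
converges. Residuals tend to zero, hence weak cluster points are fixed points by demiclosedness, and
Opial's argument shows that there is only one. Weak cluster points are handled as limits along
ultrafilters, which avoids extracting subsequences.
-/

/-! ### Subgradients, proximity operators and Moreau's decomposition -/

section Subgradient

variable {E : Type*} [NormedAddCommGroup E] [InnerProductSpace ℝ E]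

/-- `g` is a subgradient of `f` at `p`. The value `f p` is required to be a real number, so that the
affine function `u ↦ f p + ⟪g, u - p⟫` can be written with real arithmetic. -/
def HasSubgradient (f : E → EReal) (p g : E) : Prop :=
  ∃ r : ℝ, f p = r ∧ ∀ u, ((r + ⟪g, u - p⟫ : ℝ) : EReal) ≤ f u

theorem HasSubgradient.inner_nonneg {f : E → EReal} {p q g h : E}
    (hp : HasSubgradient f p g) (hq : HasSubgradient f q h) : 0 ≤ ⟪g - h, p - q⟫ := by
  obtain ⟨r, hr, h1⟩ := hp
  obtain ⟨s, hs, h2⟩ := hq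
  have h1 := h1 q
  have h2 := h2 p
  rw [hs, EReal.coe_le_coe_iff] at h1
  rw [hr, EReal.coe_le_coe_iff] at h2
  have e1 : ⟪g, q - p⟫ = -⟪g, p - q⟫ := by rw [← inner_neg_right, neg_sub]
  rw [inner_sub_left]
  linarith

/-- The easy half of the inversion `∂f* = (∂f)⁻¹`, which holds without any assumption on `f`. -/
theorem HasSubgradient.fenchelConj {f : E → EReal} {p g : E} (h : HasSubgradient f p g) :
    HasSubgradient (fenchelConj f) g p := by
  obtain ⟨r, hr, h1⟩ := h
  refine ⟨⟪p, g⟫ - r, ?_, fun u => ?_⟩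
  · apply le_antisymm
    · refine iSup_le fun u => ?_
      have h2 := h1 u
      induction hu : f u with
      | bot => rw [hu] at h2; simp at h2
      | top => simp
      | coe s =>
        rw [hu, EReal.coe_le_coe_iff, inner_sub_right, real_inner_comm u g,
          real_inner_comm p g] at h2
        rw [← EReal.coe_sub, EReal.coe_le_coe_iff]
        linarith
    · refine le_trans ?_ (le_iSup _ p)
      rw [hr, ← EReal.coe_sub]
  · refine le_trans ?_ (le_iSup _ p)
    rw [hr, ← EReal.coe_sub, EReal.coe_le_coe_iff, inner_sub_right]
    linarith

/-- Fermat's rule for the proximity operator. No regularity of `f` is needed: the quadratic term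
makes `p` the only minimizer as soon as the resolvent inclusion holds. -/
theorem HasSubgradient.prox_eq {f : E → EReal} {t : ℝ} (ht : 0 < t) {x p : E}
    (h : HasSubgradient f p (t⁻¹ • (x - p))) : prox t f x = p := by
  obtain ⟨r, hr, h1⟩ := h
  have key : ∀ u, ((t * r + ‖x - p‖ ^ 2 / 2 + ‖u - p‖ ^ 2 / 2 : ℝ) : EReal) ≤
      proxObjective (fun u => (t : EReal) * f u) x u := by
    intro u
    have h2 := h1 u
    change _ ≤ (t : EReal) * f u + _
    induction hu : f u with
    | bot => rw [hu] at h2; simp at h2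
    | top => rw [EReal.coe_mul_top_of_pos ht, EReal.top_add_coe]; exact le_top
    | coe s =>
      rw [hu, EReal.coe_le_coe_iff, real_inner_smul_left] at h2
      rw [← EReal.coe_mul, ← EReal.coe_add, EReal.coe_le_coe_iff]
      have e : ‖x - u‖ ^ 2 = ‖x - p‖ ^ 2 - 2 * ⟪x - p, u - p⟫ + ‖u - p‖ ^ 2 := by
        rw [← norm_sub_sq_real]; congr 2; abel
      have h3 := mul_le_mul_of_nonneg_left h2 ht.le
      rw [mul_add, ← mul_assoc, mul_inv_cancel₀ ht.ne', one_mul] at h3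
      linarith
  have hp : proxObjective (fun u => (t : EReal) * f u) x p =
      ((t * r + ‖x - p‖ ^ 2 / 2 : ℝ) : EReal) := by
    simp only [proxObjective, hr]
    rw [← EReal.coe_mul, ← EReal.coe_add]
  have hmin : IsMinOn (proxObjective (fun u => (t : EReal) * f u) x) univ p := by
    intro u _
    refine le_trans ?_ (key u)
    rw [hp, EReal.coe_le_coe_iff]
    linarith [sq_nonneg ‖u - p‖]
  have hprox : IsMinOn (proxObjective (fun u => (t : EReal) * f u) x) univ (prox t f x) :=
    Classical.epsilon_spec (p := fun p => IsMinOn (proxObjective (fun u => (t : EReal) * f u) x)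
      univ p) ⟨p, hmin⟩
  have h3 := (key (prox t f x)).trans (hprox (mem_univ p))
  rw [hp, EReal.coe_le_coe_iff] at h3
  have h4 : ‖prox t f x - p‖ ^ 2 ≤ 0 := by linarith
  have h5 : ‖prox t f x - p‖ = 0 := by
    nlinarith [norm_nonneg (prox t f x - p)]
  exact sub_eq_zero.mp (norm_eq_zero.mp h5)

namespace GammaZero

variable {f : E → EReal}

theorem convex_le (hf : GammaZero f) {x y : E} {r s a b : ℝ} (hx : f x ≤ r) (hy : f y ≤ s)
    (ha : 0 ≤ a) (hb : 0 ≤ b) (hab : a + b = 1) :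
    f (a • x + b • y) ≤ ((a * r + b * s : ℝ) : EReal) := by
  rcases ha.eq_or_lt with rfl | ha'
  · obtain rfl : b = 1 := by linarith
    simpa using hy
  rcases hb.eq_or_lt with rfl | hb'
  · obtain rfl : a = 1 := by linarith
    simpa using hx
  refine (hf.convex x y a b ha' hb' hab).trans ?_
  rw [EReal.coe_add, EReal.coe_mul, EReal.coe_mul]
  exact add_le_add (mul_le_mul_of_nonneg_left hx (by exact_mod_cast ha))
    (mul_le_mul_of_nonneg_left hy (by exact_mod_cast hb))

theorem exists_eq_coe (hf : GammaZero f) {x : E} (hx : f x ≠ ⊤) : ∃ r : ℝ, f x = r :=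
  ⟨(f x).toReal, (EReal.coe_toReal hx (hf.ne_bot x)).symm⟩

/-- A function in `Γ₀` decreases at most linearly: lower semicontinuity bounds it from below near
a point of its domain, and convexity propagates that bound along rays. -/
theorem exists_lower_bound (hf : GammaZero f) :
    ∃ (x₀ : E) (c M : ℝ), 0 < M ∧ ∀ (u : E) (s : ℝ), f u ≤ s → c - M * ‖u - x₀‖ ≤ s := by
  obtain ⟨x₀, hx₀⟩ := hf.exists_ne_top
  obtain ⟨r, hr⟩ := hf.exists_eq_coe hx₀
  have h1 : ∀ᶠ u in 𝓝 x₀, ((r - 1 : ℝ) : EReal) < f u := by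
    apply hf.lsc x₀
    rw [hr]
    exact EReal.coe_lt_coe_iff.mpr (by linarith)
  obtain ⟨ε, hε, h2⟩ := Metric.eventually_nhds_iff.mp h1
  refine ⟨x₀, r - 1, 2 / ε, by positivity, fun u s hs => ?_⟩
  by_cases hu : ‖u - x₀‖ < ε
  · have h3 := (h2 (by rwa [dist_eq_norm])).trans_le hs
    rw [EReal.coe_lt_coe_iff] at h3
    have : 0 ≤ 2 / ε * ‖u - x₀‖ := by positivity
    linarith
  · push Not at hu
    have hpos : 0 < ‖u - x₀‖ := hε.trans_le hu
    set l : ℝ := ε / (2 * ‖u - x₀‖) with hl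
    have hl0 : 0 < l := by positivity
    have hl1 : l ≤ 1 := by
      rw [hl, div_le_one (by positivity)]; linarith
    have h3 := hf.convex_le hr.le hs (sub_nonneg.mpr hl1) hl0.le (by ring)
    have h4 : ((r - 1 : ℝ) : EReal) < f ((1 - l) • x₀ + l • u) := by
      apply h2
      have : (1 - l) • x₀ + l • u - x₀ = l • (u - x₀) := by module
      rw [dist_eq_norm, this, norm_smul, Real.norm_of_nonneg hl0.le, hl]
      field_simp
      linarith
    have h5 := h4.trans_le h3
    rw [EReal.coe_lt_coe_iff] at h5
    have h6 : l * (2 / ε * ‖u - x₀‖) = 1 := by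
      rw [hl]; field_simp
    by_contra hcon
    push Not at hcon
    have := mul_lt_mul_of_pos_left hcon hl0
    nlinarith

/-- Minty's theorem for subdifferentials: the resolvent of `∂f` is defined everywhere. The point
`p` is the minimizer of `f + ‖x - ·‖² / (2t)`, found as the limit of a minimizing sequence. -/
theorem exists_resolvent [CompleteSpace E] (hf : GammaZero f) {t : ℝ} (ht : 0 < t) (x : E) :
    ∃ p, HasSubgradient f p (t⁻¹ • (x - p)) := by
  set R : Set ℝ := {v | ∃ (u : E) (s : ℝ), f u ≤ s ∧ v = s + ‖x - u‖ ^ 2 / (2 * t)} with hR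
  have hne : R.Nonempty := by
    obtain ⟨x₀, hx₀⟩ := hf.exists_ne_top
    obtain ⟨r, hr⟩ := hf.exists_eq_coe hx₀
    exact ⟨_, x₀, r, hr.le, rfl⟩
  have hbdd : BddBelow R := by
    obtain ⟨x₀, c, M, hM, hlow⟩ := hf.exists_lower_bound
    refine ⟨c - M * ‖x - x₀‖ - M ^ 2 * t / 2, ?_⟩
    rintro _ ⟨u, s, hs, rfl⟩
    have h1 := hlow u s hs
    have h2 : ‖u - x₀‖ ≤ ‖x - u‖ + ‖x - x₀‖ := by
      have := norm_sub_le (x - x₀) (x - u)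
      rw [show x - x₀ - (x - u) = u - x₀ by abel] at this
      linarith
    have h3 := mul_le_mul_of_nonneg_left h2 hM.le
    have h4 : 0 ≤ (‖x - u‖ - M * t) ^ 2 / (2 * t) := by positivity
    have h5 : (‖x - u‖ - M * t) ^ 2 / (2 * t) =
        ‖x - u‖ ^ 2 / (2 * t) - M * ‖x - u‖ + M ^ 2 * t / 2 := by
      field_simp; ring
    linarith
  set m := sInf R with hm
  have hmle : ∀ (u : E) (s : ℝ), f u ≤ s → m ≤ s + ‖x - u‖ ^ 2 / (2 * t) := fun u s hs =>
    csInf_le hbdd ⟨u, s, hs, rfl⟩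
  have hseq : ∀ n : ℕ, ∃ (u : E) (s : ℝ), f u ≤ s ∧
      s + ‖x - u‖ ^ 2 / (2 * t) < m + 1 / ((n : ℝ) + 1) := by
    intro n
    obtain ⟨_, ⟨u, s, hs, rfl⟩, h⟩ := exists_lt_of_csInf_lt hne
      (lt_add_of_pos_right m (Nat.one_div_pos_of_nat (n := n)))
    exact ⟨u, s, hs, h⟩
  choose u s hus hlt using hseq
  -- the parallelogram identity, with the midpoint as competitor
  have hpar : ∀ n k, ‖u n - u k‖ ^ 2 ≤ 4 * t * (1 / ((n : ℝ) + 1) + 1 / ((k : ℝ) + 1)) := by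
    intro n k
    have h1 := hf.convex_le (hus n) (hus k) (a := 1 / 2) (b := 1 / 2) (by norm_num) (by norm_num)
      (by norm_num)
    have h2 := hmle _ _ h1
    have h3 := parallelogram_law_with_norm ℝ (x - u n) (x - u k)
    have e1 : x - u n + (x - u k) = (2 : ℝ) • (x - ((1 / 2 : ℝ) • u n + (1 / 2 : ℝ) • u k)) := by
      module
    have e2 : x - u n - (x - u k) = -(u n - u k) := by abel
    rw [e1, e2, norm_neg, norm_smul, Real.norm_of_nonneg (by norm_num : (0 : ℝ) ≤ 2)] at h3
    have h4 := hlt n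
    have h5 := hlt k
    set q := ‖x - ((1 / 2 : ℝ) • u n + (1 / 2 : ℝ) • u k)‖
    have h6 : ‖u n - u k‖ ^ 2 / (4 * t) ≤ 1 / ((n : ℝ) + 1) + 1 / ((k : ℝ) + 1) := by
      have : ‖u n - u k‖ ^ 2 / (4 * t) = ‖x - u n‖ ^ 2 / (2 * t) + ‖x - u k‖ ^ 2 / (2 * t)
          - 2 * (q ^ 2 / (2 * t)) := by
        field_simp; nlinarith
      linarith
    rw [div_le_iff₀ (by positivity)] at h6
    linarith
  have hcau : CauchySeq u := by
    rw [Metric.cauchySeq_iff']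
    intro ε hε
    obtain ⟨N, hN⟩ := exists_nat_one_div_lt (show 0 < ε ^ 2 / (8 * t) by positivity)
    refine ⟨N, fun n hn => ?_⟩
    have h1 := hpar n N
    have h2 : 1 / ((n : ℝ) + 1) ≤ 1 / ((N : ℝ) + 1) := Nat.one_div_le_one_div hn
    rw [dist_eq_norm]
    rw [lt_div_iff₀ (by positivity)] at hN
    refine lt_of_pow_lt_pow_left₀ 2 hε.le ?_
    nlinarith
  obtain ⟨p, hp⟩ := cauchySeq_tendsto_of_complete hcau
  set r : ℝ := m - ‖x - p‖ ^ 2 / (2 * t) with hr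
  have hfr : f p ≤ r := by
    by_contra hcon
    push Not at hcon
    obtain ⟨b, hb1, hb2⟩ := EReal.exists_between_coe_real hcon
    rw [EReal.coe_lt_coe_iff] at hb1
    have h1 : ∀ᶠ n in atTop, ((b : ℝ) : EReal) < f (u n) := hp.eventually (hf.lsc p b hb2)
    have h2 : Tendsto (fun n : ℕ => m + 1 / ((n : ℝ) + 1) - ‖x - u n‖ ^ 2 / (2 * t)) atTop
        (𝓝 (m + 0 - ‖x - p‖ ^ 2 / (2 * t))) :=
      (tendsto_const_nhds.add tendsto_one_div_add_atTop_nhds_zero_nat).sub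
        (((tendsto_const_nhds.sub hp).norm.pow 2).div_const _)
    rw [add_zero] at h2
    obtain ⟨n, hn1, hn2⟩ := (h1.and (h2.eventually_lt_const hb1)).exists
    have h3 := hn1.trans_le (hus n)
    rw [EReal.coe_lt_coe_iff] at h3
    linarith [hlt n]
  refine ⟨p, r, le_antisymm hfr ?_, fun w => ?_⟩
  · obtain ⟨r', hr'⟩ := hf.exists_eq_coe (ne_top_of_le_ne_top (EReal.coe_ne_top r) hfr)
    rw [hr', EReal.coe_le_coe_iff]
    linarith [hmle p r' hr'.le]
  · by_cases hw : f w = ⊤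
    · rw [hw]; exact le_top
    obtain ⟨s', hs'⟩ := hf.exists_eq_coe hw
    rw [hs', EReal.coe_le_coe_iff, real_inner_smul_left]
    -- compare `p` with `p + l (w - p)` and let `l` tend to zero
    have hl : ∀ l : ℝ, 0 < l → l ≤ 1 →
        r + t⁻¹ * ⟪x - p, w - p⟫ - s' ≤ l * (‖w - p‖ ^ 2 / (2 * t)) := by
      intro l hl0 hl1
      have h1 := hmle _ _ (hf.convex_le hfr hs'.le (sub_nonneg.mpr hl1) hl0.le (by ring))
      have e : ‖x - ((1 - l) • p + l • w)‖ ^ 2 =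
          ‖x - p‖ ^ 2 - 2 * (l * ⟪x - p, w - p⟫) + l ^ 2 * ‖w - p‖ ^ 2 := by
        rw [show x - ((1 - l) • p + l • w) = (x - p) - l • (w - p) by module, norm_sub_sq_real,
          real_inner_smul_right, norm_smul, mul_pow, Real.norm_eq_abs, sq_abs]
      rw [e] at h1
      have h2 : (‖x - p‖ ^ 2 - 2 * (l * ⟪x - p, w - p⟫) + l ^ 2 * ‖w - p‖ ^ 2) / (2 * t) =
          ‖x - p‖ ^ 2 / (2 * t) - l * (t⁻¹ * ⟪x - p, w - p⟫) + l * (l * (‖w - p‖ ^ 2 / (2 * t))) := by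
        field_simp
      rw [h2] at h1
      have h3 : l * (r + t⁻¹ * ⟪x - p, w - p⟫ - s') ≤ l * (l * (‖w - p‖ ^ 2 / (2 * t))) := by
        linarith
      exact le_of_mul_le_mul_left h3 hl0
    have h2 : Tendsto (fun l : ℝ => l * (‖w - p‖ ^ 2 / (2 * t))) (𝓝[>] 0)
        (𝓝 (0 * (‖w - p‖ ^ 2 / (2 * t)))) :=
      (tendsto_id.mono_left nhdsWithin_le_nhds).mul_const _
    rw [zero_mul] at h2
    have h3 : ∀ᶠ l : ℝ in 𝓝[>] 0, r + t⁻¹ * ⟪x - p, w - p⟫ - s' ≤ l * (‖w - p‖ ^ 2 / (2 * t)) := by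
      filter_upwards [Ioc_mem_nhdsGT (zero_lt_one' ℝ)] with l hl'
      exact hl l hl'.1 hl'.2
    linarith [ge_of_tendsto h2 h3]

theorem hasSubgradient_prox [CompleteSpace E] (hf : GammaZero f) {t : ℝ} (ht : 0 < t) (x : E) :
    HasSubgradient f (prox t f x) (t⁻¹ • (x - prox t f x)) := by
  obtain ⟨p, hp⟩ := hf.exists_resolvent ht x
  rwa [hp.prox_eq ht]

/-- Moreau's decomposition. It gives the resolvent inclusion for `f*` directly in terms of `∂f`,
so that the biconjugate of `f` is never needed. -/
theorem hasSubgradient_prox_fenchelConj [CompleteSpace E] (hf : GammaZero f) {t : ℝ} (ht : 0 < t)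
    (w : E) :
    HasSubgradient f (t⁻¹ • (w - prox t (fenchelConj f) w)) (prox t (fenchelConj f) w) := by
  obtain ⟨p, hp⟩ := hf.exists_resolvent (inv_pos.mpr ht) (t⁻¹ • w)
  have hq : (t⁻¹)⁻¹ • (t⁻¹ • w - p) = w - t • p := by
    rw [inv_inv, smul_sub, smul_smul, mul_inv_cancel₀ ht.ne', one_smul]
  rw [hq] at hp
  have e : t⁻¹ • (w - (w - t • p)) = p := by
    rw [sub_sub_cancel, smul_smul, inv_mul_cancel₀ ht.ne', one_smul]
  have h2 := hp.fenchelConj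
  have h3 : prox t (fenchelConj f) w = w - t • p :=
    HasSubgradient.prox_eq ht (by rwa [e])
  rwa [h3, e]

end GammaZero

end Subgradient

/-! ### Weak limits in Hilbert spaces -/

section WeakLimits

variable {E : Type*} [NormedAddCommGroup E] [InnerProductSpace ℝ E] [CompleteSpace E]

/-- Weak compactness of balls, in terms of ultrafilters. The pointwise limit of the functionals
`⟪u i, ·⟫` along an ultrafilter is linear and bounded, so Riesz' theorem applies. -/
theorem exists_weak_limit {ι : Type*} (𝓤 : Ultrafilter ι) {u : ι → E} {C : ℝ}
    (hu : ∀ i, ‖u i‖ ≤ C) : ∃ z, ∀ w, Tendsto (fun i => ⟪u i, w⟫) 𝓤 (𝓝 ⟪z, w⟫) := by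
  have hex : ∀ w, ∃ a ∈ Icc (-(C * ‖w‖)) (C * ‖w‖), Tendsto (fun i => ⟪u i, w⟫) 𝓤 (𝓝 a) := by
    intro w
    refine isCompact_Icc.ultrafilter_le_nhds' (𝓤.map fun i => ⟪u i, w⟫) ?_
    refine Ultrafilter.mem_map.mpr (Eventually.of_forall fun i => ?_)
    exact abs_le.mp ((abs_real_inner_le_norm _ _).trans
      (mul_le_mul_of_nonneg_right (hu i) (norm_nonneg w)))
  choose l hl hlim using hex
  let φ : E →ₗ[ℝ] ℝ :=
    { toFun := l
      map_add' := fun v w => tendsto_nhds_unique (hlim (v + w)) (by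
        simpa only [inner_add_right] using (hlim v).add (hlim w))
      map_smul' := fun c w => tendsto_nhds_unique (hlim (c • w)) (by
        simpa only [real_inner_smul_right, RingHom.id_apply, smul_eq_mul]
          using (hlim w).const_mul c) }
  refine ⟨(InnerProductSpace.toDual ℝ E).symm (φ.mkContinuous C fun w => abs_le.mpr (hl w)),
    fun w => ?_⟩
  rw [InnerProductSpace.toDual_symm_apply]
  exact hlim w

/-- The projection of a closed convex set along a Hilbert space factor is closed if that factor is
bounded on the set: it is weakly compact there. -/
theorem isClosed_image_snd_of_bounded {V : Type*} [NormedAddCommGroup V] [NormedSpace ℝ V]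
    {D : Set (E × V)} (hD : IsClosed D) (hconv : Convex ℝ D) {C : ℝ}
    (hC : ∀ z ∈ D, ‖z.1‖ ≤ C) : IsClosed (Prod.snd '' D) := by
  refine IsSeqClosed.isClosed fun p p₀ hp hlim => ?_
  choose z hzD hz using hp
  let 𝓤 : Ultrafilter ℕ := Ultrafilter.of atTop
  have h𝓤 : (𝓤 : Filter ℕ) ≤ atTop := Ultrafilter.of_le atTop
  obtain ⟨x, hx⟩ := exists_weak_limit 𝓤 (fun n => hC (z n) (hzD n))
  refine ⟨(x, p₀), ?_, rfl⟩
  by_contra hcon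
  obtain ⟨f, a, hfa, hfD⟩ := geometric_hahn_banach_point_closed hconv hD hcon
  have hsplit : ∀ y : E × V, f y =
      ⟪y.1, (InnerProductSpace.toDual ℝ E).symm (f.comp (.inl ℝ E V))⟫ + f (0, y.2) := by
    intro y
    rw [real_inner_comm, InnerProductSpace.toDual_symm_apply, ContinuousLinearMap.comp_apply,
      ContinuousLinearMap.inl_apply, ← map_add]
    simp
  have h1 : Tendsto (fun n => f (z n)) 𝓤 (𝓝 (f (x, p₀))) := by
    rw [hsplit (x, p₀)]
    refine Tendsto.congr (fun n => (hsplit (z n)).symm) ?_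
    refine (hx _).add ?_
    · have h2 : Continuous fun q : V => f (0, q) := by fun_prop
      have h3 := ((h2.tendsto p₀).comp hlim).mono_left h𝓤
      simpa only [Function.comp_def, ← hz] using h3
  exact (ge_of_tendsto h1 (Eventually.of_forall fun n => (hfD _ (hzD n)).le)).not_gt hfa

end WeakLimits

/-! ### Duality under the qualification condition -/

section Duality

/-- A convex function on a Banach space, with epigraph `U`, has an affine minorant that is exact at
`0` as soon as `0` is in the strong relative interior of its domain and the domain is a countable
union of closed sets on which the function is bounded above. By Baire's theorem the epigraph then
has interior points in the closed span of the domain, and a supporting hyperplane at the lowest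
point over `0` is not vertical. -/
theorem exists_le_of_zero_mem_intrinsicInterior {V : Type*} [NormedAddCommGroup V]
    [NormedSpace ℝ V] [CompleteSpace V] {U : Set (V × ℝ)} (hU : Convex ℝ U)
    (hup : ∀ p s s', (p, s) ∈ U → s ≤ s' → (p, s') ∈ U)
    (hint : (0 : V) ∈ intrinsicInterior ℝ (Prod.fst '' U))
    (hclosed : IsClosed (affineSpan ℝ (Prod.fst '' U) : Set V))
    {C : ℕ → Set V} {M : ℕ → ℝ} (hC : ∀ n, IsClosed (C n))
    (hcover : ∀ z ∈ U, ∃ n, z.1 ∈ C n) (hCU : ∀ n, ∀ p ∈ C n, (p, M n) ∈ U)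
    {m : ℝ} (hm : ∀ s, (0, s) ∈ U → m ≤ s) :
    ∃ g : StrongDual ℝ V, ∀ z ∈ U, m + g z.1 ≤ z.2 := by
  set S : Set V := Prod.fst '' U with hS
  have h0S : (0 : V) ∈ S := intrinsicInterior_subset hint
  have h0A : (0 : V) ∈ affineSpan ℝ S := subset_affineSpan ℝ S h0S
  set L : Submodule ℝ V := (affineSpan ℝ S).direction with hL
  have hmemL : ∀ p, p ∈ L ↔ p ∈ affineSpan ℝ S := fun p => by
    simpa using AffineSubspace.vadd_mem_iff_mem_direction p h0A |>.symm
  have hSL : ∀ p ∈ S, p ∈ L := fun p hp => (hmemL p).mpr (subset_affineSpan ℝ S hp)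
  have hLclosed : IsClosed (L : Set V) := by
    convert hclosed using 1
    ext p
    exact hmemL p
  have : CompleteSpace L := hLclosed.completeSpace_coe
  obtain ⟨ε, hε, hball⟩ : ∃ ε > 0, ∀ p : L, ‖p‖ < ε → (p : V) ∈ S := by
    obtain ⟨z, hz, hz0⟩ := hint
    rw [mem_interior_iff_mem_nhds, Metric.mem_nhds_iff] at hz
    obtain ⟨ε, hε, h⟩ := hz
    refine ⟨ε, hε, fun p hp => ?_⟩
    refine @h ⟨p, (hmemL p).mp p.2⟩ ?_
    rw [Metric.mem_ball, Subtype.dist_eq, hz0, dist_zero_right]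
    exact hp
  set U' : Set (L × ℝ) := {z | ((z.1 : V), z.2) ∈ U} with hU'
  have hU'conv : Convex ℝ U' := by
    intro z hz w hw a b ha hb hab
    have := hU hz hw ha hb hab
    simpa [hU'] using this
  have hU'int : (interior U').Nonempty := by
    obtain ⟨⟨k, n⟩, p₁, hp₁⟩ := nonempty_interior_of_iUnion_of_closed
      (f := fun i : ℕ × ℕ => {p : L | ((i.1 : ℝ) + 1)⁻¹ • (p : V) ∈ C i.2})
      (fun i => (hC i.2).preimage (by fun_prop)) (by
        refine eq_univ_of_forall fun p => ?_
        obtain ⟨k, hk⟩ := exists_nat_gt (‖p‖ / ε)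
        have hk' : ‖((k : ℝ) + 1)⁻¹ • p‖ < ε := by
          rw [norm_smul, Real.norm_of_nonneg (by positivity), inv_mul_lt_iff₀ (by positivity)]
          rw [div_lt_iff₀ hε] at hk
          linarith
        obtain ⟨z, hz, hzp⟩ := hball _ hk'
        obtain ⟨n, hn⟩ := hcover z hz
        refine mem_iUnion.mpr ⟨(k, n), ?_⟩
        rw [hzp] at hn
        exact hn)
    have hk : ((k : ℝ) + 1) ≠ 0 := by positivity
    have hopen : IsOpen {z : L × ℝ | ((k : ℝ) + 1) • z.1 ∈
        interior {p : L | ((k : ℝ) + 1)⁻¹ • (p : V) ∈ C n} ∧ M n < z.2} :=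
      (isOpen_interior.preimage (continuous_fst.const_smul ((k : ℝ) + 1))).inter
        (isOpen_lt continuous_const continuous_snd)
    refine ⟨(((k : ℝ) + 1)⁻¹ • p₁, M n + 1), mem_interior.mpr ⟨_, ?_, hopen, ?_⟩⟩
    · rintro z ⟨hz1, hz2⟩
      have h1 := interior_subset hz1
      rw [mem_ofPred_eq, Submodule.coe_smul, smul_smul, inv_mul_cancel₀ hk, one_smul] at h1
      exact hup _ _ _ (hCU n _ h1) hz2.le
    · refine ⟨?_, by simp⟩
      rw [smul_smul, mul_inv_cancel₀ hk, one_smul]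
      exact hp₁
  have hnot : ((0 : L), m) ∉ interior U' := by
    intro h
    have hcont : Tendsto (fun s : ℝ => ((0 : L), s)) (𝓝 m) (𝓝 (0, m)) :=
      (Continuous.prodMk continuous_const continuous_id).tendsto m
    have h1 : ∀ᶠ s in 𝓝 m, ((0 : L), s) ∈ U' := hcont (mem_interior_iff_mem_nhds.mp h)
    obtain ⟨δ, hδ, h2⟩ := Metric.eventually_nhds_iff.mp h1
    have h3 := hm _ (h2 (y := m - δ / 2) (by
      rw [Real.dist_eq, sub_sub_cancel_left, abs_neg, abs_of_pos (by positivity)]; linarith))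
    linarith
  obtain ⟨f, hf0, hf⟩ := geometric_hahn_banach_of_nonempty_interior_point hU'conv hnot hU'int
  set c : ℝ := f (0, 1) with hc
  have hsplit : ∀ (p : L) (s : ℝ), f (p, s) = f (p, 0) + s * c := by
    intro p s
    rw [hc, ← smul_eq_mul, ← map_smul, ← map_add]
    simp
  have hle : ∀ (p : L) (s : ℝ), ((p : V), s) ∈ U → f (p, 0) + s * c ≤ m * c := by
    intro p s hps
    have h1 := hf (p, s) hps
    rw [hsplit p s, hsplit 0 m] at h1
    have h2 : f ((0 : L), (0 : ℝ)) = 0 := map_zero f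
    linarith
  have hc0 : c ≤ 0 := by
    obtain ⟨⟨q, s₀⟩, hz, hz0⟩ := h0S
    obtain rfl : q = 0 := hz0
    have h1 := hle 0 (max s₀ (m + 1)) (hup _ _ _ hz (le_max_left _ _))
    have h2 : f ((0 : L), (0 : ℝ)) = 0 := map_zero f
    have h3 : m + 1 ≤ max s₀ (m + 1) := le_max_right _ _
    by_contra hcon
    push Not at hcon
    nlinarith
  have hc1 : c ≠ 0 := by
    intro hc1
    have h1 : ∀ p : L, ‖p‖ < ε → f (p, 0) ≤ 0 := by
      intro p hp
      obtain ⟨⟨q, s⟩, hz, hzp⟩ := hball p hp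
      obtain rfl : q = p := hzp
      simpa [hc1] using hle p s hz
    have h2 : ∀ p : L, f (p, 0) ≤ 0 := by
      intro p
      obtain ⟨k, hk⟩ := exists_nat_gt (‖p‖ / ε)
      have hk' : ‖((k : ℝ) + 1)⁻¹ • p‖ < ε := by
        rw [norm_smul, Real.norm_of_nonneg (by positivity), inv_mul_lt_iff₀ (by positivity)]
        rw [div_lt_iff₀ hε] at hk
        linarith
      have h3 := h1 _ hk'
      have h4 : f (((k : ℝ) + 1)⁻¹ • p, (0 : ℝ)) = ((k : ℝ) + 1)⁻¹ * f (p, 0) := by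
        rw [← smul_eq_mul, ← map_smul]; simp
      rw [h4] at h3
      by_contra hcon
      push Not at hcon
      have : 0 < ((k : ℝ) + 1)⁻¹ * f (p, 0) := by positivity
      linarith
    refine hf0 (ContinuousLinearMap.ext fun z => ?_)
    have h3 : f (-z.1, (0 : ℝ)) = -f (z.1, 0) := by rw [← map_neg]; simp
    have h4 := h2 (-z.1)
    have h5 := h2 z.1
    have h6 := hsplit z.1 z.2
    rw [hc1, mul_zero, add_zero] at h6
    change f (z.1, z.2) = 0
    linarith
  have hneg : 0 < -c := by
    have := lt_of_le_of_ne hc0 hc1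
    linarith
  obtain ⟨g, hg, -⟩ := exists_extension_norm_eq L ((-c)⁻¹ • f.comp (.inl ℝ L ℝ))
  refine ⟨g, fun z hz => ?_⟩
  have hzL : z.1 ∈ L := hSL _ ⟨z, hz, rfl⟩
  have h1 := hle ⟨z.1, hzL⟩ z.2 hz
  have h2 : g z.1 = (-c)⁻¹ * f (⟨z.1, hzL⟩, 0) := hg ⟨z.1, hzL⟩
  rw [h2, ← sub_nonneg]
  have h3 : z.2 - (m + (-c)⁻¹ * f (⟨z.1, hzL⟩, 0)) =
      (-c)⁻¹ * (m * c - (f (⟨z.1, hzL⟩, 0) + z.2 * c)) := by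
    field_simp
    ring
  rw [h3]
  exact mul_nonneg (inv_nonneg.mpr hneg.le) (by linarith)

namespace GammaZero

variable {E : Type*} [NormedAddCommGroup E] [InnerProductSpace ℝ E] {f : E → EReal}

theorem isClosed_sublevel (hf : GammaZero f) (r : ℝ) : IsClosed {x | f x ≤ r} :=
  hf.lsc.isClosed_preimage r

theorem convex_sublevel (hf : GammaZero f) (r : ℝ) : Convex ℝ {x | f x ≤ r} := by
  intro x hx y hy a b ha hb hab
  have := hf.convex_le hx hy ha hb hab
  rwa [← add_mul, hab, one_mul] at this

end GammaZero

variable {X Y : Type*} [NormedAddCommGroup X] [InnerProductSpace ℝ X]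
  [NormedAddCommGroup Y] [InnerProductSpace ℝ Y]
  {F : Y → EReal} {G H : X → EReal} {K : X →L[ℝ] Y}

open ContinuousLinearMap (adjoint)

/-- The epigraph of the perturbed optimal value `p ↦ inf_x G (x + p₁) + F (K x + p₂) + H x`, whose
domain is the qualification set. The real numbers `a`, `b`, `c` bound the three summands. -/
def perturbationEpigraph (F : Y → EReal) (G H : X → EReal) (K : X →L[ℝ] Y) : Set ((X × Y) × ℝ) :=
  {z | ∃ (x : X) (a b c : ℝ), G (x + z.1.1) ≤ a ∧ F (K x + z.1.2) ≤ b ∧ H x ≤ c ∧ a + b + c ≤ z.2}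

theorem convex_perturbationEpigraph (hF : GammaZero F) (hG : GammaZero G) (hH : GammaZero H) :
    Convex ℝ (perturbationEpigraph F G H K) := by
  rintro z ⟨x, a, b, c, ha, hb, hc, hs⟩ z' ⟨x', a', b', c', ha', hb', hc', hs'⟩ l l' hl hl' hll'
  refine ⟨l • x + l' • x', l * a + l' * a', l * b + l' * b', l * c + l' * c', ?_, ?_,
    hH.convex_le hc hc' hl hl' hll', ?_⟩
  · convert hG.convex_le ha ha' hl hl' hll' using 2
    simp only [Prod.fst_add, Prod.smul_fst]
    module
  · convert hF.convex_le hb hb' hl hl' hll' using 2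
    simp only [Prod.fst_add, Prod.snd_add, Prod.smul_fst, Prod.smul_snd, map_add, map_smul]
    module
  · have h1 := mul_le_mul_of_nonneg_left hs hl
    have h2 := mul_le_mul_of_nonneg_left hs' hl'
    simp only [Prod.snd_add, Prod.smul_snd, smul_eq_mul]
    linarith

theorem fst_image_perturbationEpigraph (hF : GammaZero F) (hG : GammaZero G) (hH : GammaZero H) :
    Prod.fst '' perturbationEpigraph F G H K = qualificationSet F G H K := by
  ext p
  constructor
  · rintro ⟨z, ⟨x, a, b, c, ha, hb, hc, -⟩, rfl⟩
    refine ⟨(x + z.1.1, K x + z.1.2), ⟨?_, ?_⟩, (x, K x), ⟨x, ?_, rfl⟩, ?_⟩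
    · exact ne_top_of_le_ne_top (EReal.coe_ne_top a) ha
    · exact ne_top_of_le_ne_top (EReal.coe_ne_top b) hb
    · exact ne_top_of_le_ne_top (EReal.coe_ne_top c) hc
    · simp
  · rintro ⟨⟨u, w⟩, ⟨hu, hw⟩, _, ⟨x, hx, rfl⟩, rfl⟩
    obtain ⟨a, ha⟩ := hG.exists_eq_coe hu
    obtain ⟨b, hb⟩ := hF.exists_eq_coe hw
    obtain ⟨c, hc⟩ := hH.exists_eq_coe hx
    refine ⟨((u, w) - (x, K x), a + b + c), ⟨x, a, b, c, ?_, ?_, hc.le, le_rfl⟩, rfl⟩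
    · simpa using ha.le
    · simpa using hb.le

variable [CompleteSpace X]

/-- The sets in this statement exhaust the qualification set as `n` grows. Each is the projection of
a closed convex set on which the point `x` is bounded. -/
theorem isClosed_bounded_perturbation (hF : GammaZero F) (hG : GammaZero G) (hH : GammaZero H)
    (n : ℝ) : IsClosed {p : X × Y | ∃ x : X, ‖x‖ ≤ n ∧ G (x + p.1) ≤ n ∧ F (K x + p.2) ≤ n ∧
      H x ≤ n} := by
  let A₁ : X × (X × Y) →L[ℝ] X :=
    .fst ℝ X (X × Y) + (ContinuousLinearMap.fst ℝ X Y).comp (.snd ℝ X (X × Y))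
  let A₂ : X × (X × Y) →L[ℝ] Y :=
    K.comp (.fst ℝ X (X × Y)) + (ContinuousLinearMap.snd ℝ X Y).comp (.snd ℝ X (X × Y))
  let A₃ : X × (X × Y) →L[ℝ] X := .fst ℝ X (X × Y)
  let D : Set (X × (X × Y)) := A₃ ⁻¹' Metric.closedBall 0 n ∩ (A₁ ⁻¹' {u | G u ≤ (n : ℝ)} ∩
    (A₂ ⁻¹' {w | F w ≤ (n : ℝ)} ∩ A₃ ⁻¹' {x | H x ≤ (n : ℝ)}))
  have hDc : IsClosed D := (Metric.isClosed_closedBall.preimage A₃.continuous).inter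
    (((hG.isClosed_sublevel n).preimage A₁.continuous).inter
      (((hF.isClosed_sublevel n).preimage A₂.continuous).inter
        ((hH.isClosed_sublevel n).preimage A₃.continuous)))
  have hDconv : Convex ℝ D :=
    ((convex_closedBall 0 n).linear_preimage A₃.toLinearMap).inter
    (((hG.convex_sublevel n).linear_preimage A₁.toLinearMap).inter
      (((hF.convex_sublevel n).linear_preimage A₂.toLinearMap).inter
        ((hH.convex_sublevel n).linear_preimage A₃.toLinearMap)))
  have hDb : ∀ z ∈ D, ‖z.1‖ ≤ n := fun z hz => mem_closedBall_zero_iff.mp hz.1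
  refine Eq.subst (motive := IsClosed) ?_ (isClosed_image_snd_of_bounded hDc hDconv hDb)
  ext p
  constructor
  · rintro ⟨z, ⟨h1, h2, h3, h4⟩, rfl⟩
    exact ⟨z.1, mem_closedBall_zero_iff.mp h1, h2, h3, h4⟩
  · rintro ⟨x, h1, h2, h3, h4⟩
    exact ⟨(x, p), ⟨mem_closedBall_zero_iff.mpr h1, h2, h3, h4⟩, rfl⟩

variable [CompleteSpace Y]

/-- Sufficiency of the optimality system. -/
theorem isPrimalSolution_of_hasSubgradient {x y : X} {v : Y} (hGx : HasSubgradient G x y)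
    (hFx : HasSubgradient F (K x) v) (hHx : HasSubgradient H x (-y - adjoint K v)) :
    IsPrimalSolution F G H K x := by
  obtain ⟨a, ha, h1⟩ := hGx
  obtain ⟨b, hb, h2⟩ := hFx
  obtain ⟨c, hc, h3⟩ := hHx
  intro u _
  have e1 : primalObjective F G H K x = ((b + ⟪v, K u - K x⟫ : ℝ) : EReal) +
      ((a + ⟪y, u - x⟫ : ℝ) : EReal) + ((c + ⟪-y - adjoint K v, u - x⟫ : ℝ) : EReal) := by
    rw [primalObjective, ha, hb, hc, ← EReal.coe_add, ← EReal.coe_add, ← EReal.coe_add,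
      ← EReal.coe_add, EReal.coe_eq_coe_iff, inner_sub_left, inner_neg_left,
      ContinuousLinearMap.adjoint_inner_left, map_sub]
    ring
  change primalObjective F G H K x ≤ primalObjective F G H K u
  rw [e1]
  exact add_le_add (add_le_add (h2 _) (h1 _)) (h3 _)

/-- Necessity of the optimality system: under the qualification condition (Attouch and Brezis) the
dual problem has a solution, which consists of the subgradients below. -/
theorem IsPrimalSolution.exists_hasSubgradient (hF : GammaZero F) (hG : GammaZero G)
    (hH : GammaZero H) (hqual : QualificationCondition F G H K) {x : X}
    (hx : IsPrimalSolution F G H K x) :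
    ∃ (y : X) (v : Y), HasSubgradient G x y ∧ HasSubgradient F (K x) v ∧
      HasSubgradient H x (-y - adjoint K v) := by
  have hfst := fst_image_perturbationEpigraph (K := K) hF hG hH
  -- `0` lies in the qualification set, so the optimal value is not `⊤`
  obtain ⟨z, ⟨x₀, a₀, b₀, c₀, ha₀, hb₀, hc₀, -⟩, hz0⟩ :
      (0 : X × Y) ∈ Prod.fst '' perturbationEpigraph F G H K := by
    rw [hfst]; exact intrinsicInterior_subset hqual.1
  rw [hz0] at ha₀ hb₀
  simp only [Prod.fst_zero, Prod.snd_zero, add_zero] at ha₀ hb₀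
  have hlt : primalObjective F G H K x ≤ ((b₀ + a₀ + c₀ : ℝ) : EReal) := by
    refine (hx (mem_univ x₀)).trans ?_
    rw [EReal.coe_add, EReal.coe_add]
    exact add_le_add (add_le_add hb₀ ha₀) hc₀
  have hne := ne_top_of_le_ne_top (EReal.coe_ne_top _) hlt
  rw [primalObjective] at hne
  have hFG : F (K x) + G x ≠ ⊤ := fun h => hne (by
    rw [h]; exact EReal.top_add_of_ne_bot (hH.ne_bot x))
  have hFGbot : F (K x) + G x ≠ ⊥ := by
    rw [Ne, EReal.add_eq_bot_iff]
    exact not_or.mpr ⟨hF.ne_bot _, hG.ne_bot _⟩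
  obtain ⟨c, hc⟩ := hH.exists_eq_coe (x := x) fun h => hne (by
    rw [h]; exact EReal.add_top_of_ne_bot hFGbot)
  obtain ⟨a, ha⟩ := hG.exists_eq_coe (x := x) fun h => hFG (by
    rw [h]; exact EReal.add_top_of_ne_bot (hF.ne_bot _))
  obtain ⟨b, hb⟩ := hF.exists_eq_coe (x := K x) fun h => hFG (by
    rw [h]; exact EReal.top_add_of_ne_bot (hG.ne_bot _))
  obtain ⟨g, hg⟩ := exists_le_of_zero_mem_intrinsicInterior (m := a + b + c)
    (U := perturbationEpigraph F G H K)
    (C := fun n : ℕ => {p : X × Y | ∃ x : X, ‖x‖ ≤ (n : ℝ) ∧ G (x + p.1) ≤ ((n : ℝ) : EReal) ∧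
      F (K x + p.2) ≤ ((n : ℝ) : EReal) ∧ H x ≤ ((n : ℝ) : EReal)})
    (M := fun n => n + n + n)
    (convex_perturbationEpigraph hF hG hH)
    (by
      rintro p s s' ⟨u, a, b, c, h1, h2, h3, h4⟩ hs
      exact ⟨u, a, b, c, h1, h2, h3, h4.trans hs⟩)
    (by rw [hfst]; exact hqual.1) (by rw [hfst]; exact hqual.2)
    (fun n => isClosed_bounded_perturbation hF hG hH n)
    (by
      rintro z ⟨u, a, b, c, h1, h2, h3, -⟩
      obtain ⟨n, hn⟩ := exists_nat_ge (max (max ‖u‖ a) (max b c))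
      simp only [max_le_iff] at hn
      obtain ⟨⟨hn1, hn2⟩, hn3, hn4⟩ := hn
      exact ⟨n, u, hn1, h1.trans (EReal.coe_le_coe_iff.mpr hn2),
        h2.trans (EReal.coe_le_coe_iff.mpr hn3), h3.trans (EReal.coe_le_coe_iff.mpr hn4)⟩)
    (by
      rintro n p ⟨u, -, h1, h2, h3⟩
      exact ⟨u, n, n, n, h1, h2, h3, le_rfl⟩)
    (by
      rintro s ⟨u, a', b', c', h1, h2, h3, h4⟩
      simp only [Prod.fst_zero, Prod.snd_zero, add_zero] at h1 h2
      have h5 : primalObjective F G H K x ≤ ((b' + a' + c' : ℝ) : EReal) := by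
        refine (hx (mem_univ u)).trans ?_
        rw [EReal.coe_add, EReal.coe_add]
        exact add_le_add (add_le_add h2 h1) h3
      rw [primalObjective, ha, hb, hc, ← EReal.coe_add, ← EReal.coe_add,
        EReal.coe_le_coe_iff] at h5
      linarith)
  set y : X := (InnerProductSpace.toDual ℝ X).symm (g.comp (.inl ℝ X Y)) with hy
  set v : Y := (InnerProductSpace.toDual ℝ Y).symm (g.comp (.inr ℝ X Y)) with hv
  have hgyv : ∀ p : X × Y, g p = ⟪y, p.1⟫ + ⟪v, p.2⟫ := by
    intro p
    rw [hy, hv, InnerProductSpace.toDual_symm_apply, InnerProductSpace.toDual_symm_apply,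
      ContinuousLinearMap.comp_apply, ContinuousLinearMap.comp_apply,
      ContinuousLinearMap.inl_apply, ContinuousLinearMap.inr_apply, ← map_add]
    simp
  have key : ∀ (u w : X) (q : Y) (a' b' c' : ℝ), G u = a' → F q = b' → H w = c' →
      a + b + c + (⟪y, u - w⟫ + ⟪v, q - K w⟫) ≤ a' + b' + c' := by
    intro u w q a' b' c' h1 h2 h3
    have := hg ((u - w, q - K w), a' + b' + c')
      ⟨w, a', b', c', by simpa using h1.le, by simpa using h2.le, h3.le, le_rfl⟩
    rwa [hgyv] at this
  refine ⟨y, v, ⟨a, ha, fun u => ?_⟩, ⟨b, hb, fun q => ?_⟩, ⟨c, hc, fun w => ?_⟩⟩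
  · by_cases hu : G u = ⊤
    · rw [hu]; exact le_top
    obtain ⟨a', ha'⟩ := hG.exists_eq_coe hu
    have := key u x (K x) a' b c ha' hb hc
    rw [sub_self, inner_zero_right] at this
    rw [ha', EReal.coe_le_coe_iff]
    linarith
  · by_cases hq : F q = ⊤
    · rw [hq]; exact le_top
    obtain ⟨b', hb'⟩ := hF.exists_eq_coe hq
    have := key x x q a b' c ha hb' hc
    rw [sub_self, inner_zero_right] at this
    rw [hb', EReal.coe_le_coe_iff]
    linarith
  · by_cases hw : H w = ⊤
    · rw [hw]; exact le_top
    obtain ⟨c', hc'⟩ := hH.exists_eq_coe hw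
    have := key x w (K x) a b c' ha hb hc'
    rw [hc', EReal.coe_le_coe_iff, inner_sub_left, inner_neg_left,
      ContinuousLinearMap.adjoint_inner_left, map_sub, ← neg_sub x w, ← neg_sub (K x) (K w),
      inner_neg_right, inner_neg_right]
    linarith

end Duality

/-! ### Real sequences satisfying an inertial inequality -/

section RealSequences

/-- The lemma of Alvarez and Attouch: the positive parts of the increments are summable, so `φ`
differs from an antitone sequence by a convergent one. -/
theorem exists_tendsto_of_inertial_le {φ e a : ℕ → ℝ} {α : ℝ} (hα : α < 1)
    (hφ : ∀ k, 0 ≤ φ k) (ha : ∀ k, 0 ≤ a k ∧ a k ≤ α) (he : ∀ k, 0 ≤ e k) (hsum : Summable e)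
    (h : ∀ k, φ (k + 2) - φ (k + 1) ≤ a k * (φ (k + 1) - φ k) + e k) :
    ∃ l, Tendsto φ atTop (𝓝 l) := by
  set θ : ℕ → ℝ := fun k => max (φ (k + 1) - φ k) 0 with hθ
  have hθ0 : ∀ k, 0 ≤ θ k := fun k => le_max_right _ _
  have hα0 : 0 ≤ α := (ha 0).1.trans (ha 0).2
  have hstep : ∀ k, θ (k + 1) ≤ α * θ k + e k := by
    intro k
    have h1 : a k * (φ (k + 1) - φ k) ≤ a k * θ k :=
      mul_le_mul_of_nonneg_left (le_max_left _ _) (ha k).1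
    have h2 : a k * θ k ≤ α * θ k := mul_le_mul_of_nonneg_right (ha k).2 (hθ0 k)
    refine max_le ?_ (add_nonneg (mul_nonneg hα0 (hθ0 k)) (he k))
    linarith [h k]
  have hθsum : Summable θ := by
    refine summable_of_sum_range_le (c := (θ 0 + ∑' k, e k) / (1 - α)) hθ0 fun n => ?_
    rw [le_div_iff₀ (by linarith)]
    have h1 : ∑ k ∈ Finset.range (n + 1), θ k ≤
        α * ∑ k ∈ Finset.range n, θ k + ∑' k, e k + θ 0 := by
      rw [Finset.sum_range_succ']
      have h2 : ∑ k ∈ Finset.range n, θ (k + 1) ≤ ∑ k ∈ Finset.range n, (α * θ k + e k) :=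
        Finset.sum_le_sum fun k _ => hstep k
      rw [Finset.sum_add_distrib, ← Finset.mul_sum] at h2
      linarith [hsum.sum_le_tsum (Finset.range n) fun k _ => he k]
    rw [Finset.sum_range_succ] at h1
    linarith [hθ0 n]
  set ψ : ℕ → ℝ := fun k => φ k - ∑ j ∈ Finset.range k, θ j with hψ
  have hanti : Antitone ψ := antitone_nat_of_succ_le fun k => by
    simp only [hψ, Finset.sum_range_succ]
    have : φ (k + 1) - φ k ≤ θ k := le_max_left _ _
    linarith
  have hbdd : BddBelow (range ψ) := by
    refine ⟨-∑' k, θ k, ?_⟩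
    rintro _ ⟨k, rfl⟩
    have := hθsum.sum_le_tsum (Finset.range k) fun k _ => hθ0 k
    simp only [hψ]
    linarith [hφ k]
  refine ⟨_, ((tendsto_atTop_ciInf hanti hbdd).add hθsum.hasSum.tendsto_sum_nat).congr fun k => ?_⟩
  simp [hψ]

/-- In the application `φ k` is the squared distance of the `k`-th iterate to a fixed point and `D k`
is the squared length of the increment from `k` to `k + 1`. The energy
`φ (k + 1) - a k * φ k + c k * D k` is nonincreasing, because `a` is nondecreasing, and its decrease
controls `D`. -/
theorem summable_and_exists_tendsto_of_inertial_le {φ D a c : ℕ → ℝ} {α Γ θ : ℝ} (hα : α < 1)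
    (hθ : 0 < θ) (hφ : ∀ k, 0 ≤ φ k) (hD : ∀ k, 0 ≤ D k) (ha : ∀ k, 0 ≤ a k ∧ a k ≤ α)
    (hmono : ∀ k, a k ≤ a (k + 1)) (ha0 : a 0 = 0) (hc : ∀ k, 0 ≤ c k ∧ c k ≤ Γ) (hc0 : c 0 = 0)
    (h : ∀ k, φ (k + 2) ≤ (1 + a k) * φ (k + 1) - a k * φ k + c k * D k
      - (c (k + 1) + θ) * D (k + 1)) :
    Summable D ∧ ∃ l, Tendsto φ atTop (𝓝 l) := by
  have hα0 : 0 ≤ α := (ha 0).1.trans (ha 0).2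
  set μ : ℕ → ℝ := fun k => φ (k + 1) - a k * φ k + c k * D k with hμ
  have hμ0 : μ 0 = φ 1 := by simp [hμ, ha0, hc0]
  have hdec : ∀ k, μ (k + 1) + θ * D (k + 1) ≤ μ k := by
    intro k
    have h1 := h k
    have h2 := mul_le_mul_of_nonneg_right (hmono k) (hφ (k + 1))
    simp only [hμ]
    linarith
  have hμsum : ∀ n, μ n + θ * ∑ k ∈ Finset.range n, D (k + 1) ≤ φ 1 := by
    intro n
    induction n with
    | zero => simp [hμ0]
    | succ n ih =>
      rw [Finset.sum_range_succ, mul_add]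
      linarith [hdec n]
  have hlow : ∀ n, φ (n + 1) - α * φ n ≤ μ n := by
    intro n
    have h1 := mul_le_mul_of_nonneg_right (ha n).2 (hφ n)
    have h2 := mul_nonneg (hc n).1 (hD n)
    simp only [hμ]
    linarith
  have hSnonneg : ∀ n, 0 ≤ θ * ∑ k ∈ Finset.range n, D (k + 1) := fun n =>
    mul_nonneg hθ.le (Finset.sum_nonneg fun k _ => hD _)
  have hbound : ∀ n, φ n ≤ φ 0 + φ 1 / (1 - α) := by
    intro n
    induction n with
    | zero =>
      have : 0 ≤ φ 1 / (1 - α) := div_nonneg (hφ 1) (by linarith)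
      linarith
    | succ n ih =>
      have h1 := hμsum n
      have h2 := hlow n
      have h3 := hSnonneg n
      have h4 : φ 1 = (1 - α) * (φ 1 / (1 - α)) := by
        field_simp [show (1 - α) ≠ 0 by linarith]
      have h5 := mul_le_mul_of_nonneg_left ih hα0
      have h6 : 0 ≤ (1 - α) * φ 0 := mul_nonneg (by linarith) (hφ 0)
      nlinarith
  have hDsum : Summable D := by
    rw [← summable_nat_add_iff 1]
    refine summable_of_sum_range_le (c := (φ 1 + α * (φ 0 + φ 1 / (1 - α))) / θ)
      (fun k => hD _) fun n => ?_
    rw [le_div_iff₀ hθ]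
    have h5 := mul_le_mul_of_nonneg_left (hbound n) hα0
    linarith [hμsum n, hlow n, hφ (n + 1)]
  refine ⟨hDsum, exists_tendsto_of_inertial_le (e := fun k => Γ * D k) hα hφ ha
    (fun k => mul_nonneg ((hc k).1.trans (hc k).2) (hD k)) (hDsum.mul_left Γ) fun k => ?_⟩
  have h1 := h k
  have h2 := mul_le_mul_of_nonneg_right (hc k).2 (hD k)
  have h3 : 0 ≤ (c (k + 1) + θ) * D (k + 1) := mul_nonneg (add_nonneg (hc _).1 hθ.le) (hD _)
  linarith

end RealSequences

/-! ### The inertial Krasnosel'skiĭ–Mann iteration in a variable metric -/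

section Inertial

variable {E : Type*} [NormedAddCommGroup E] [InnerProductSpace ℝ E]

/-- The basic estimate of one inertial step, in terms of `s = a + δ ρ`. Here `d'` and `d` are the
squared lengths of the new and the old increment and `b` is their inner product, which is absorbed
by the square of `new - s • old`. -/
theorem inertial_step_le {a ρ δ φ₀ φ₁ φ₂ d d' b : ℝ} (ha : 0 ≤ a) (hρ : 0 < ρ) (hρ1 : ρ ≤ 1)
    (hδ : 0 < δ) (hsq : 0 ≤ d' - 2 * (a + δ * ρ) * b + (a + δ * ρ) ^ 2 * d)
    (h : φ₂ ≤ (1 + a) * φ₁ - a * φ₀ + a * (1 + a) * d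
      - (1 - ρ) / ρ * (d' - 2 * a * b + a ^ 2 * d)) :
    φ₂ ≤ (1 + a) * φ₁ - a * φ₀ + (a * (1 + a) + a * δ * (1 - ρ)) * d
      - (1 - ρ) * δ / (a + δ * ρ) * d' := by
  have hs : 0 < a + δ * ρ := by positivity
  have h1 : (1 - ρ) / ρ * (d' - 2 * a * b + a ^ 2 * d) =
      (1 - ρ) / ρ * (a / (a + δ * ρ)) * (d' - 2 * (a + δ * ρ) * b + (a + δ * ρ) ^ 2 * d)
      + (1 - ρ) * δ / (a + δ * ρ) * d' - a * δ * (1 - ρ) * d := by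
    field_simp
    ring
  have h2 : 0 ≤ (1 - ρ) / ρ * (a / (a + δ * ρ)) *
      (d' - 2 * (a + δ * ρ) * b + (a + δ * ρ) ^ 2 * d) :=
    mul_nonneg (mul_nonneg (div_nonneg (by linarith) hρ.le) (div_nonneg ha hs.le)) hsq
  linarith

/-- The upper bound on the relaxation parameters says that the gain `(1 - ρ) δ / (a + δ ρ)` of a step
in the square of the new increment exceeds by at least `θ` the loss, at most
`α (1 + α) + α δ`, that this increment causes in the next step. -/
theorem relaxation_bound {α θ δ a ρ : ℝ} (ha : 0 ≤ a) (haα : a ≤ α) (hθ : 0 < θ) (hδ : 0 < δ)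
    (hρ : 0 < ρ) (h : ρ < (δ - α * (α * (1 + α) + α * δ + θ)) /
      (δ * (1 + α * (1 + α) + α * δ + θ))) :
    ρ < 1 ∧ α * (1 + α) + α * δ + θ ≤ (1 - ρ) * δ / (a + δ * ρ) := by
  have hα : 0 ≤ α := ha.trans haα
  set Γ := α * (1 + α) + α * δ + θ with hΓ
  have hΓ0 : 0 < Γ := by positivity
  have e : 1 + α * (1 + α) + α * δ + θ = 1 + Γ := by rw [hΓ]; ring
  rw [e, lt_div_iff₀ (by positivity)] at h
  have h2 : 0 < δ * ρ := by positivity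
  have h1 : (a + δ * ρ) * Γ ≤ (α + δ * ρ) * Γ :=
    mul_le_mul_of_nonneg_right (by linarith) hΓ0.le
  have h3 : 0 ≤ (a + δ * ρ) * Γ := by positivity
  refine ⟨?_, ?_⟩
  · by_contra hcon
    push Not at hcon
    nlinarith
  · rw [le_div_iff₀ (by positivity)]
    linarith

variable {B : E →L[ℝ] E →L[ℝ] ℝ} {T : E → E}

/-- One relaxed step from `w` towards `T w`, for an operator `T` that is firmly nonexpansive in the
metric of `B`. -/
theorem relaxed_step_le (hsymm : ∀ u v, B u v = B v u)
    (hT : ∀ u v, 0 ≤ B ((u - T u) - (v - T v)) (T u - T v)) {p w z : E} {ρ : ℝ} (hρ : 0 < ρ)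
    (hp : T p = p) (hpos : ∀ u, 0 ≤ B u u) (hz : z = ρ • T w + (1 - ρ) • w) :
    B (z - p) (z - p) ≤ B (w - p) (w - p) - (1 - ρ) / ρ * B (z - w) (z - w) := by
  have h1 := hT w p
  rw [hp, sub_self, sub_zero] at h1
  obtain ⟨e, he⟩ : ∃ e, e = w - T w := ⟨_, rfl⟩
  obtain ⟨t, ht⟩ : ∃ t, t = T w - p := ⟨_, rfl⟩
  have e1 : z - p = t + (1 - ρ) • e := by rw [hz, he, ht]; module
  have e2 : w - p = t + e := by rw [he, ht]; abel
  have e3 : z - w = (-ρ) • e := by rw [hz, he]; module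
  rw [← he, ← ht] at h1
  rw [e1, e2, e3]
  simp only [map_add, map_smul, add_apply, smul_apply,
    smul_eq_mul]
  rw [hsymm t e]
  have h2 := hpos e
  have h3 : (1 - ρ) / ρ * (-ρ * (-ρ * B e e)) = (1 - ρ) * ρ * B e e := by
    field_simp
  rw [h3]
  have h4 := mul_nonneg hρ.le h1
  have h5 := mul_nonneg hρ.le h2
  nlinarith

theorem inertial_extrapolation (hsymm : ∀ u v, B u v = B v u) (z₁ z₀ p : E) (a : ℝ) :
    B (z₁ + a • (z₁ - z₀) - p) (z₁ + a • (z₁ - z₀) - p) =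
      (1 + a) * B (z₁ - p) (z₁ - p) - a * B (z₀ - p) (z₀ - p)
        + a * (1 + a) * B (z₁ - z₀) (z₁ - z₀) := by
  obtain ⟨u, hu⟩ : ∃ u, u = z₁ - p := ⟨_, rfl⟩
  obtain ⟨v, hv⟩ : ∃ v, v = z₀ - p := ⟨_, rfl⟩
  have e1 : z₁ + a • (z₁ - z₀) - p = (1 + a) • u - a • v := by rw [hu, hv]; module
  have e2 : z₁ - z₀ = u - v := by rw [hu, hv]; abel
  rw [e1, e2, ← hu, ← hv]
  simp only [map_sub, map_smul, sub_apply, smul_apply,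
    smul_eq_mul]
  rw [hsymm v u]
  ring

theorem bilin_sub_smul_self (hsymm : ∀ u v, B u v = B v u) (u v : E) (s : ℝ) :
    B (u - s • v) (u - s • v) = B u u - 2 * s * B u v + s ^ 2 * B v v := by
  simp only [map_sub, map_smul, sub_apply, smul_apply,
    smul_eq_mul]
  rw [hsymm v u]
  ring

/-- Demiclosedness of `T - id` along a filter, for an operator `T` that is firmly nonexpansive in
the metric of `B`. -/
theorem fixed_of_tendsto_weakly {ι : Type*} {l : Filter ι} [l.NeBot]
    (hdef : ∀ u, B u u ≤ 0 → u = 0)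
    (hT : ∀ u v, 0 ≤ B ((u - T u) - (v - T v)) (T u - T v)) {w : ι → E} {p : E} {C : ℝ}
    (hw : ∀ i, ‖w i‖ ≤ C) (hres : Tendsto (fun i => w i - T (w i)) l (𝓝 0))
    (hweak : ∀ f : StrongDual ℝ E, Tendsto (fun i => f (w i)) l (𝓝 (f p))) : T p = p := by
  set e : ι → E := fun i => w i - T (w i) with he
  have hTw : ∀ i, T (w i) = w i - e i := fun i => by simp [he]
  -- both arguments vary in `B (e i) (w i)`, but `e i → 0` strongly and `w i` is bounded
  have h1 : Tendsto (fun i => B (e i) (w i)) l (𝓝 0) := by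
    refine squeeze_zero_norm (a := fun i => ‖B‖ * ‖e i‖ * C) (fun i => ?_) ?_
    · exact (B.le_opNorm₂ _ _).trans (mul_le_mul_of_nonneg_left (hw i) (by positivity))
    · simpa using (hres.norm.const_mul ‖B‖).mul_const C
  have h2 : Tendsto (fun i => B (e i) (e i)) l (𝓝 0) := by
    simpa only [Function.comp_def, Function.uncurry_apply_pair, map_zero] using
      (B.continuous₂.tendsto (0, 0)).comp (hres.prodMk_nhds hres)
  have h3 : Tendsto (fun i => B (e i) (T p)) l (𝓝 0) := by
    simpa only [Function.comp_def, Function.uncurry_apply_pair, map_zero, zero_apply] using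
      (B.continuous₂.tendsto (0, T p)).comp (hres.prodMk_nhds tendsto_const_nhds)
  obtain ⟨c, hc⟩ : ∃ c, c = p - T p := ⟨_, rfl⟩
  have h4 := hweak (B c)
  have h5 : Tendsto (fun i => B c (e i)) l (𝓝 0) := by
    simpa only [Function.comp_def, map_zero] using ((B c).continuous.tendsto 0).comp hres
  have h6 : Tendsto (fun i => B (e i) (w i) - B (e i) (e i) - B (e i) (T p)
      - (B c (w i) - B c (e i) - B c (T p))) l
      (𝓝 (0 - 0 - 0 - (B c p - 0 - B c (T p)))) :=
    ((h1.sub h2).sub h3).sub ((h4.sub h5).sub tendsto_const_nhds)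
  have h7 : 0 ≤ 0 - 0 - 0 - (B c p - 0 - B c (T p)) := by
    refine ge_of_tendsto' h6 fun i => ?_
    have h : 0 ≤ B (e i - c) (w i - e i - T p) := by
      rw [← hTw i, hc]
      exact hT (w i) p
    rw [map_sub B (e i) c, sub_apply, map_sub (B (e i)), map_sub (B (e i)), map_sub (B c),
      map_sub (B c)] at h
    linarith
  have h8 : B c c ≤ 0 := by
    nth_rewrite 2 [hc]
    rw [map_sub (B c)]
    linarith
  exact (sub_eq_zero.mp (hc ▸ hdef c h8)).symm

/-- Weak convergence of the inertial Krasnosel'skiĭ–Mann iteration, for an operator that is firmly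
nonexpansive with respect to the inner product `B`, which is equivalent to that of `E`. -/
theorem exists_weak_limit_inertial [CompleteSpace E] (hsymm : ∀ u v, B u v = B v u) {κ : ℝ}
    (hκ : 0 < κ) (hcoer : ∀ u, κ * ‖u‖ ^ 2 ≤ B u u)
    (hT : ∀ u v, 0 ≤ B ((u - T u) - (v - T v)) (T u - T v)) (hfix : ∃ p, T p = p)
    {a ρ : ℕ → ℝ} {α ρmin θ δ : ℝ} (hα : α < 1) (ha : ∀ k, 0 ≤ a k ∧ a k ≤ α)
    (hmono : ∀ k, a k ≤ a (k + 1)) (ha0 : a 0 = 0) (hρmin : 0 < ρmin) (hθ : 0 < θ) (hδ : 0 < δ)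
    (hρ : ∀ k, ρmin ≤ ρ k ∧ ρ k < (δ - α * (α * (1 + α) + α * δ + θ)) /
      (δ * (1 + α * (1 + α) + α * δ + θ)))
    {z w : ℕ → E} (hw : ∀ k, w k = z (k + 1) + a k • (z (k + 1) - z k))
    (hz : ∀ k, z (k + 2) = ρ k • T (w k) + (1 - ρ k) • w k) :
    ∃ p, T p = p ∧ ∀ v, Tendsto (fun k => ⟪z k, v⟫) atTop (𝓝 ⟪p, v⟫) := by
  have hα0 : 0 ≤ α := (ha 0).1.trans (ha 0).2
  have hpos : ∀ u, 0 ≤ B u u := fun u => (by positivity : 0 ≤ κ * ‖u‖ ^ 2).trans (hcoer u)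
  have hdef : ∀ u, B u u ≤ 0 → u = 0 := by
    intro u hu
    have h1 : κ * ‖u‖ ^ 2 ≤ 0 := (hcoer u).trans hu
    have h2 : ‖u‖ ^ 2 ≤ 0 := nonpos_of_mul_nonpos_right h1 hκ
    exact norm_eq_zero.mp (pow_eq_zero_iff two_ne_zero |>.mp (le_antisymm h2 (sq_nonneg _)))
  have hnorm : ∀ {u : ℕ → E}, Tendsto (fun k => B (u k) (u k)) atTop (𝓝 0) →
      Tendsto u atTop (𝓝 0) := by
    intro u hu
    rw [tendsto_zero_iff_norm_tendsto_zero]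
    have h1 : Tendsto (fun k => ‖u k‖ ^ 2) atTop (𝓝 0) := by
      refine squeeze_zero (fun k => sq_nonneg _) (fun k => ?_) (by simpa using hu.div_const κ)
      rw [le_div_iff₀ hκ, mul_comm]
      exact hcoer (u k)
    simpa using h1.sqrt
  have hρ0 : ∀ k, 0 < ρ k := fun k => hρmin.trans_le (hρ k).1
  have hρ1 := fun k => relaxation_bound (ha k).1 (ha k).2 hθ hδ (hρ0 k) (hρ k).2
  set D : ℕ → ℝ := fun k => B (z (k + 1) - z k) (z (k + 1) - z k) with hD
  have hD0 : ∀ k, 0 ≤ D k := fun k => hpos _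
  have hincr : ∀ k, z (k + 2) - w k = (z (k + 2) - z (k + 1)) - a k • (z (k + 1) - z k) := by
    intro k; rw [hw k]; abel
  have henergy : ∀ p, T p = p →
      Summable D ∧ ∃ l, Tendsto (fun k => B (z k - p) (z k - p)) atTop (𝓝 l) := by
    intro p hp
    refine summable_and_exists_tendsto_of_inertial_le (a := a) (Γ := α * (1 + α) + α * δ)
      (c := fun k => a k * (1 + a k) + a k * δ * (1 - ρ k)) hα hθ (fun k => hpos _) hD0 ha hmono
      ha0 (fun k => ?_) (by simp [ha0]) (fun k => ?_)
    · obtain ⟨h1, h2⟩ := ha k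
      have h3 := (hρ1 k).1
      have h4 := hρ0 k
      have h5 : 0 ≤ a k * δ * (1 - ρ k) :=
        mul_nonneg (mul_nonneg h1 hδ.le) (by linarith)
      have h6 : a k * δ * (1 - ρ k) ≤ α * δ * 1 :=
        mul_le_mul (mul_le_mul_of_nonneg_right h2 hδ.le) (by linarith) (by linarith)
          (by positivity)
      have h7 : a k * (1 + a k) ≤ α * (1 + α) :=
        mul_le_mul h2 (by linarith) (by linarith) hα0
      exact ⟨add_nonneg (mul_nonneg h1 (by linarith)) h5, by linarith⟩
    · have h1 := relaxed_step_le hsymm hT (hρ0 k) hp hpos (hz k)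
      rw [hincr, bilin_sub_smul_self hsymm] at h1
      nth_rewrite 1 [hw k] at h1
      nth_rewrite 1 [hw k] at h1
      rw [inertial_extrapolation hsymm] at h1
      have h2 := hpos ((z (k + 2) - z (k + 1)) - (a k + δ * ρ k) • (z (k + 1) - z k))
      rw [bilin_sub_smul_self hsymm] at h2
      have h3 := inertial_step_le (ha k).1 (hρ0 k) (hρ1 k).1.le hδ h2 h1
      -- the coefficient of the new increment dominates the next one of the old increment
      have h4 : a (k + 1) * (1 + a (k + 1)) + a (k + 1) * δ * (1 - ρ (k + 1)) + θ ≤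
          (1 - ρ k) * δ / (a k + δ * ρ k) := by
        refine le_trans ?_ (hρ1 k).2
        obtain ⟨g1, g2⟩ := ha (k + 1)
        have g3 := (hρ1 (k + 1)).1
        have g4 := hρ0 (k + 1)
        have g6 : a (k + 1) * δ * (1 - ρ (k + 1)) ≤ α * δ * 1 :=
          mul_le_mul (mul_le_mul_of_nonneg_right g2 hδ.le) (by linarith) (by linarith)
            (by positivity)
        have g7 : a (k + 1) * (1 + a (k + 1)) ≤ α * (1 + α) :=
          mul_le_mul g2 (by linarith) (by linarith) hα0
        linarith
      have h5 := mul_le_mul_of_nonneg_right h4 (hD0 (k + 1))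
      simp only [hD] at h5 ⊢
      linarith
  obtain ⟨p₀, hp₀⟩ := hfix
  obtain ⟨hDsum, l₀, hl₀⟩ := henergy p₀ hp₀
  have hDlim : Tendsto D atTop (𝓝 0) := hDsum.tendsto_atTop_zero
  have hzd : Tendsto (fun k => z (k + 1) - z k) atTop (𝓝 0) := hnorm hDlim
  have hres : Tendsto (fun k => w k - T (w k)) atTop (𝓝 0) := by
    have h1 : Tendsto (fun k => z (k + 2) - w k) atTop (𝓝 0) := by
      have h2 : Tendsto (fun k => a k • (z (k + 1) - z k)) atTop (𝓝 0) := by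
        refine squeeze_zero_norm (a := fun k => α * ‖z (k + 1) - z k‖) (fun k => ?_)
          (by simpa using hzd.norm.const_mul α)
        rw [norm_smul, Real.norm_of_nonneg (ha k).1]
        exact mul_le_mul_of_nonneg_right (ha k).2 (norm_nonneg _)
      have h3 := ((tendsto_add_atTop_iff_nat 1).mpr hzd).sub h2
      rw [sub_zero] at h3
      exact h3.congr fun k => (hincr k).symm
    refine squeeze_zero_norm (a := fun k => ‖z (k + 2) - w k‖ / ρmin) (fun k => ?_)
      (by simpa using h1.norm.div_const ρmin)
    have h4 : z (k + 2) - w k = (-ρ k) • (w k - T (w k)) := by rw [hz k]; module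
    rw [le_div_iff₀ hρmin, h4, norm_smul, norm_neg, Real.norm_of_nonneg (hρ0 k).le, mul_comm]
    exact mul_le_mul_of_nonneg_right (hρ k).1 (norm_nonneg _)
  have hwz : Tendsto (fun k => w k - z (k + 1)) atTop (𝓝 0) := by
    refine squeeze_zero_norm (a := fun k => α * ‖z (k + 1) - z k‖) (fun k => ?_)
      (by simpa using hzd.norm.const_mul α)
    rw [hw k, add_sub_cancel_left, norm_smul, Real.norm_of_nonneg (ha k).1]
    exact mul_le_mul_of_nonneg_right (ha k).2 (norm_nonneg _)
  obtain ⟨C, hC⟩ : ∃ C, ∀ k, ‖z k‖ ≤ C := by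
    obtain ⟨M, hM⟩ := hl₀.bddAbove_range
    refine ⟨√(M / κ) + ‖p₀‖, fun k => ?_⟩
    have h1 : ‖z k - p₀‖ ≤ √(M / κ) := by
      refine Real.le_sqrt_of_sq_le ?_
      rw [le_div_iff₀ hκ, mul_comm]
      exact (hcoer _).trans (hM ⟨k, rfl⟩)
    linarith [norm_sub_norm_le (z k) p₀]
  obtain ⟨C', hC'⟩ : ∃ C', ∀ k, ‖w k‖ ≤ C' := by
    refine ⟨C + α * (C + C), fun k => ?_⟩
    rw [hw k]
    refine (norm_add_le _ _).trans (add_le_add (hC _) ?_)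
    rw [norm_smul, Real.norm_of_nonneg (ha k).1]
    exact mul_le_mul (ha k).2 ((norm_sub_le _ _).trans (add_le_add (hC _) (hC _)))
      (norm_nonneg _) hα0
  -- every weak cluster point of the shifted sequence is a fixed point
  have hcluster : ∀ 𝓤 : Ultrafilter ℕ, (𝓤 : Filter ℕ) ≤ atTop → ∃ p, T p = p ∧
      ∀ f : StrongDual ℝ E, Tendsto (fun k => f (z (k + 1))) 𝓤 (𝓝 (f p)) := by
    intro 𝓤 h𝓤
    obtain ⟨p, hp⟩ := exists_weak_limit 𝓤 fun k => hC (k + 1)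
    have hf : ∀ f : StrongDual ℝ E, Tendsto (fun k => f (z (k + 1))) 𝓤 (𝓝 (f p)) := by
      intro f
      have h1 := hp ((InnerProductSpace.toDual ℝ E).symm f)
      simpa only [real_inner_comm ((InnerProductSpace.toDual ℝ E).symm f),
        InnerProductSpace.toDual_symm_apply] using h1
    refine ⟨p, fixed_of_tendsto_weakly hdef hT hC' (hres.mono_left h𝓤) fun f => ?_, hf⟩
    have h2 : Tendsto (fun k => f (w k - z (k + 1))) 𝓤 (𝓝 0) := by
      simpa only [Function.comp_def, map_zero] using
        ((f.continuous.tendsto 0).comp hwz).mono_left h𝓤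
    have h3 := (hf f).add h2
    rw [add_zero] at h3
    exact h3.congr fun k => by rw [map_sub]; ring
  -- Opial's argument: two weak cluster points coincide
  have hunique : ∀ 𝓤 𝓥 : Ultrafilter ℕ, (𝓤 : Filter ℕ) ≤ atTop → (𝓥 : Filter ℕ) ≤ atTop →
      ∀ p q, T p = p → T q = q →
      (∀ f : StrongDual ℝ E, Tendsto (fun k => f (z (k + 1))) 𝓤 (𝓝 (f p))) →
      (∀ f : StrongDual ℝ E, Tendsto (fun k => f (z (k + 1))) 𝓥 (𝓝 (f q))) → p = q := by
    intro 𝓤 𝓥 h𝓤 h𝓥 p q hp hq hpf hqf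
    obtain ⟨-, lp, hlp⟩ := henergy p hp
    obtain ⟨-, lq, hlq⟩ := henergy q hq
    have h1 : Tendsto (fun k => B (p - q) (z (k + 1))) atTop
        (𝓝 ((lq - lp - (B q q - B p p)) / 2)) := by
      have h2 := (((hlq.sub hlp).sub_const (B q q - B p p)).div_const 2)
      refine ((tendsto_add_atTop_iff_nat 1).mpr h2).congr fun k => ?_
      simp only [map_sub, sub_apply]
      rw [hsymm (z (k + 1)) p, hsymm (z (k + 1)) q]
      ring
    have h3 := tendsto_nhds_unique (hpf (B (p - q))) (h1.mono_left h𝓤)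
    have h4 := tendsto_nhds_unique (hqf (B (p - q))) (h1.mono_left h𝓥)
    refine sub_eq_zero.mp (hdef _ ?_)
    rw [map_sub (B (p - q))]
    linarith
  obtain ⟨p, hp, hpf⟩ := hcluster (Ultrafilter.of atTop) (Ultrafilter.of_le atTop)
  refine ⟨p, hp, fun v => (tendsto_add_atTop_iff_nat 1).mp ?_⟩
  rw [tendsto_iff_ultrafilter]
  intro 𝓤 h𝓤
  obtain ⟨q, hq, hqf⟩ := hcluster 𝓤 h𝓤
  obtain rfl := hunique _ 𝓤 (Ultrafilter.of_le atTop) h𝓤 p q hp hq hpf hqf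
  simpa only [innerSL_apply_apply, real_inner_comm v] using hqf (innerSL ℝ v)

end Inertial

/-! ### The primal-dual step as a firmly nonexpansive operator -/

section PrimalDualStep

open ContinuousLinearMap (adjoint)

variable {X Y : Type*} [NormedAddCommGroup X] [InnerProductSpace ℝ X]
  [NormedAddCommGroup Y] [InnerProductSpace ℝ Y]

/-- The Hilbert sum `X ⊕ X ⊕ Y` in which the triples `(x, y, v)` live. -/
abbrev PDSpace (X Y : Type*) : Type _ := WithLp 2 (X × WithLp 2 (X × Y))

/-- The point of `PDSpace X Y` with the given components. -/
def pdMk (x y : X) (v : Y) : PDSpace X Y := WithLp.toLp 2 (x, WithLp.toLp 2 (y, v))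

/-- The inner product in which the primal-dual step is a resolvent. It is represented by the
operator matrix with rows `(σ⁻¹, -1, -K*)`, `(-1, γ⁻¹, 0)` and `(-K, 0, τ⁻¹)`. -/
noncomputable def pdForm (σ γ τ : ℝ) (K : X →L[ℝ] Y) :
    PDSpace X Y →L[ℝ] PDSpace X Y →L[ℝ] ℝ :=
  let p₁ : PDSpace X Y →L[ℝ] X := WithLp.fstL 2 ℝ X (WithLp 2 (X × Y))
  let p₂ : PDSpace X Y →L[ℝ] X :=
    (WithLp.fstL 2 ℝ X Y).comp (WithLp.sndL 2 ℝ X (WithLp 2 (X × Y)))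
  let p₃ : PDSpace X Y →L[ℝ] Y :=
    (WithLp.sndL 2 ℝ X Y).comp (WithLp.sndL 2 ℝ X (WithLp 2 (X × Y)))
  σ⁻¹ • (innerSL ℝ).bilinearComp p₁ p₁ + γ⁻¹ • (innerSL ℝ).bilinearComp p₂ p₂
    + τ⁻¹ • (innerSL ℝ).bilinearComp p₃ p₃
    - (innerSL ℝ).bilinearComp p₁ p₂ - (innerSL ℝ).bilinearComp p₂ p₁
    - (innerSL ℝ).bilinearComp (K.comp p₁) p₃ - (innerSL ℝ).bilinearComp p₃ (K.comp p₁)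

theorem pdForm_apply (σ γ τ : ℝ) (K : X →L[ℝ] Y) (u w : PDSpace X Y) :
    pdForm σ γ τ K u w = σ⁻¹ * ⟪u.fst, w.fst⟫ + γ⁻¹ * ⟪u.snd.fst, w.snd.fst⟫
      + τ⁻¹ * ⟪u.snd.snd, w.snd.snd⟫ - ⟪u.fst, w.snd.fst⟫ - ⟪u.snd.fst, w.fst⟫
      - ⟪K u.fst, w.snd.snd⟫ - ⟪u.snd.snd, K w.fst⟫ := rfl

theorem pdForm_comm (σ γ τ : ℝ) (K : X →L[ℝ] Y) (u w : PDSpace X Y) :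
    pdForm σ γ τ K u w = pdForm σ γ τ K w u := by
  rw [pdForm_apply, pdForm_apply, real_inner_comm u.fst w.fst, real_inner_comm u.snd.fst w.snd.fst,
    real_inner_comm u.snd.snd w.snd.snd, real_inner_comm u.fst w.snd.fst,
    real_inner_comm u.snd.fst w.fst, real_inner_comm (K u.fst) w.snd.snd,
    real_inner_comm u.snd.snd (K w.fst)]
  ring

theorem pdForm_coercive {σ γ τ : ℝ} (hσ : 0 < σ) (hγ : 0 < γ) (hτ : 0 < τ) {K : X →L[ℝ] Y}
    (hstep : σ * γ + σ * τ * ‖K‖ ^ 2 < 1) :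
    ∃ κ > 0, ∀ u : PDSpace X Y, κ * ‖u‖ ^ 2 ≤ pdForm σ γ τ K u u := by
  set s := γ + τ * ‖K‖ ^ 2 with hs
  have hs0 : 0 < s := by positivity
  have hσs : σ * s < 1 := by rw [hs]; linarith
  -- the mixed terms are split by Young's inequality with weight `t`, where `σ s < t < 1`
  set t := (1 + σ * s) / 2 with ht
  have ht0 : 0 < t := by positivity
  have ht1 : t < 1 := by rw [ht]; linarith
  have hst : 0 < σ⁻¹ - s / t := by
    rw [sub_pos, div_lt_iff₀ ht0, inv_mul_eq_div, lt_div_iff₀ hσ, ht]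
    linarith
  have hγt : 0 < (1 - t) / γ := div_pos (by linarith) hγ
  have hτt : 0 < (1 - t) / τ := div_pos (by linarith) hτ
  refine ⟨min (σ⁻¹ - s / t) (min ((1 - t) / γ) ((1 - t) / τ)), by positivity, fun u => ?_⟩
  set κ := min (σ⁻¹ - s / t) (min ((1 - t) / γ) ((1 - t) / τ)) with hκ
  have hκ1 : κ ≤ σ⁻¹ - s / t := min_le_left _ _
  have hκ2 : κ ≤ (1 - t) / γ := (min_le_right _ _).trans (min_le_left _ _)
  have hκ3 : κ ≤ (1 - t) / τ := (min_le_right _ _).trans (min_le_right _ _)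
  have hnorm : ‖u‖ ^ 2 = ‖u.fst‖ ^ 2 + (‖u.snd.fst‖ ^ 2 + ‖u.snd.snd‖ ^ 2) := by
    rw [WithLp.prod_norm_sq_eq_of_L2, ← WithLp.prod_norm_sq_eq_of_L2 u.snd]
  rw [pdForm_apply, hnorm, real_inner_self_eq_norm_sq, real_inner_self_eq_norm_sq,
    real_inner_self_eq_norm_sq, real_inner_comm u.fst u.snd.fst,
    real_inner_comm (K u.fst) u.snd.snd]
  have h1 : ⟪u.fst, u.snd.fst⟫ ≤ ‖u.fst‖ * ‖u.snd.fst‖ := real_inner_le_norm _ _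
  have h2 : ⟪K u.fst, u.snd.snd⟫ ≤ ‖K‖ * ‖u.fst‖ * ‖u.snd.snd‖ :=
    (real_inner_le_norm _ _).trans
      (mul_le_mul_of_nonneg_right (K.le_opNorm _) (norm_nonneg _))
  set a := ‖u.fst‖
  set b := ‖u.snd.fst‖
  set c := ‖u.snd.snd‖
  have h3 : 2 * (a * b) ≤ γ / t * a ^ 2 + t / γ * b ^ 2 := by
    have : 0 ≤ (γ * a - t * b) ^ 2 / (γ * t) := by positivity
    have e : (γ * a - t * b) ^ 2 / (γ * t) = γ / t * a ^ 2 + t / γ * b ^ 2 - 2 * (a * b) := by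
      field_simp; ring
    linarith
  have h4 : 2 * (‖K‖ * a * c) ≤ τ * ‖K‖ ^ 2 / t * a ^ 2 + t / τ * c ^ 2 := by
    have : 0 ≤ (τ * ‖K‖ * a - t * c) ^ 2 / (τ * t) := by positivity
    have e : (τ * ‖K‖ * a - t * c) ^ 2 / (τ * t) =
        τ * ‖K‖ ^ 2 / t * a ^ 2 + t / τ * c ^ 2 - 2 * (‖K‖ * a * c) := by
      field_simp; ring
    linarith
  have h5 := mul_le_mul_of_nonneg_right hκ1 (sq_nonneg a)
  have h6 := mul_le_mul_of_nonneg_right hκ2 (sq_nonneg b)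
  have h7 := mul_le_mul_of_nonneg_right hκ3 (sq_nonneg c)
  have e1 : (σ⁻¹ - s / t) * a ^ 2 =
      σ⁻¹ * a ^ 2 - γ / t * a ^ 2 - τ * ‖K‖ ^ 2 / t * a ^ 2 := by rw [hs]; ring
  have e2 : (1 - t) / γ * b ^ 2 = γ⁻¹ * b ^ 2 - t / γ * b ^ 2 := by ring
  have e3 : (1 - t) / τ * c ^ 2 = τ⁻¹ * c ^ 2 - t / τ * c ^ 2 := by ring
  linarith

variable [CompleteSpace X] [CompleteSpace Y]
  {F : Y → EReal} {G H : X → EReal} {K : X →L[ℝ] Y} {σ γ τ : ℝ}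

/-- One primal-dual step without inertia and relaxation. -/
noncomputable def pdStep (F : Y → EReal) (G H : X → EReal) (K : X →L[ℝ] Y) (σ γ τ : ℝ)
    (z : PDSpace X Y) : PDSpace X Y :=
  let x' : X := prox σ H (z.fst - σ • z.snd.fst - σ • (adjoint K) z.snd.snd)
  pdMk x' (prox γ (fenchelConj G) (z.snd.fst + γ • ((2 : ℝ) • x' - z.fst)))
    (prox τ (fenchelConj F) (z.snd.snd + τ • K ((2 : ℝ) • x' - z.fst)))

/-- The step as a resolvent: with `e = z - pdStep z`, the image of `e` under the operator
representing `pdForm` is a value, at `pdStep z`, of the monotone operator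
`(x, y, v) ↦ (∂H x + y + K* v, (∂G)⁻¹ y - x, (∂F)⁻¹ v - K x)`. -/
theorem hasSubgradient_pdStep (hF : GammaZero F) (hG : GammaZero G) (hH : GammaZero H)
    (hσ : 0 < σ) (hγ : 0 < γ) (hτ : 0 < τ) {z t e : PDSpace X Y}
    (ht : pdStep F G H K σ γ τ z = t) (he : e = z - t) :
    HasSubgradient H t.fst (σ⁻¹ • e.fst - e.snd.fst - adjoint K e.snd.snd
      - t.snd.fst - adjoint K t.snd.snd) ∧
    HasSubgradient G (γ⁻¹ • e.snd.fst - e.fst + t.fst) t.snd.fst ∧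
    HasSubgradient F (τ⁻¹ • e.snd.snd - K e.fst + K t.fst) t.snd.snd := by
  subst he
  have hx : prox σ H (z.fst - σ • z.snd.fst - σ • (adjoint K) z.snd.snd) = t.fst := by
    rw [← ht]; rfl
  have hy : prox γ (fenchelConj G) (z.snd.fst + γ • ((2 : ℝ) • t.fst - z.fst)) = t.snd.fst := by
    rw [← ht]; rfl
  have hv : prox τ (fenchelConj F) (z.snd.snd + τ • K ((2 : ℝ) • t.fst - z.fst)) = t.snd.snd := by
    rw [← ht]; rfl
  have h1 := hH.hasSubgradient_prox hσ (z.fst - σ • z.snd.fst - σ • (adjoint K) z.snd.snd)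
  have h2 := hG.hasSubgradient_prox_fenchelConj hγ (z.snd.fst + γ • ((2 : ℝ) • t.fst - z.fst))
  have h3 := hF.hasSubgradient_prox_fenchelConj hτ
    (z.snd.snd + τ • K ((2 : ℝ) • t.fst - z.fst))
  rw [hx] at h1
  rw [hy] at h2
  rw [hv] at h3
  simp only [WithLp.sub_fst, WithLp.sub_snd]
  refine ⟨?_, ?_, ?_⟩
  · convert h1 using 1
    rw [map_sub]
    simp only [smul_sub, smul_smul, inv_mul_cancel₀ hσ.ne']
    module
  · convert h2 using 1
    simp only [smul_sub, smul_add, smul_smul, inv_mul_cancel₀ hγ.ne', ← mul_assoc]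
    module
  · convert h3 using 1
    simp only [map_sub, map_smul, smul_sub, smul_add, smul_smul, inv_mul_cancel₀ hτ.ne',
      ← mul_assoc]
    module

theorem pdStep_firmlyNonexpansive (hF : GammaZero F) (hG : GammaZero G) (hH : GammaZero H)
    (hσ : 0 < σ) (hγ : 0 < γ) (hτ : 0 < τ) (z w : PDSpace X Y) :
    0 ≤ pdForm σ γ τ K ((z - pdStep F G H K σ γ τ z) - (w - pdStep F G H K σ γ τ w))
      (pdStep F G H K σ γ τ z - pdStep F G H K σ γ τ w) := by
  obtain ⟨t, ht⟩ : ∃ t, pdStep F G H K σ γ τ z = t := ⟨_, rfl⟩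
  obtain ⟨s, hs⟩ : ∃ s, pdStep F G H K σ γ τ w = s := ⟨_, rfl⟩
  obtain ⟨e, he⟩ : ∃ e, e = z - t := ⟨_, rfl⟩
  obtain ⟨f, hf⟩ : ∃ f, f = w - s := ⟨_, rfl⟩
  obtain ⟨h1, h2, h3⟩ := hasSubgradient_pdStep hF hG hH hσ hγ hτ ht he
  obtain ⟨g1, g2, g3⟩ := hasSubgradient_pdStep hF hG hH hσ hγ hτ hs hf
  have k1 := h1.inner_nonneg g1
  have k2 := h2.inner_nonneg g2
  have k3 := h3.inner_nonneg g3
  rw [ht, hs, ← he, ← hf]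
  obtain ⟨d, hd⟩ : ∃ d, d = e - f := ⟨_, rfl⟩
  obtain ⟨q, hq⟩ : ∃ q, q = t - s := ⟨_, rfl⟩
  rw [← hd, ← hq]
  have e1 : (σ⁻¹ • e.fst - e.snd.fst - adjoint K e.snd.snd - t.snd.fst - adjoint K t.snd.snd) -
      (σ⁻¹ • f.fst - f.snd.fst - adjoint K f.snd.snd - s.snd.fst - adjoint K s.snd.snd) =
      σ⁻¹ • d.fst - d.snd.fst - adjoint K d.snd.snd - q.snd.fst - adjoint K q.snd.snd := by
    rw [hd, hq]; simp only [WithLp.sub_fst, WithLp.sub_snd, map_sub]; module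
  have e2 : (γ⁻¹ • e.snd.fst - e.fst + t.fst) - (γ⁻¹ • f.snd.fst - f.fst + s.fst) =
      γ⁻¹ • d.snd.fst - d.fst + q.fst := by
    rw [hd, hq]; simp only [WithLp.sub_fst, WithLp.sub_snd]; module
  have e3 : (τ⁻¹ • e.snd.snd - K e.fst + K t.fst) - (τ⁻¹ • f.snd.snd - K f.fst + K s.fst) =
      τ⁻¹ • d.snd.snd - K d.fst + K q.fst := by
    rw [hd, hq]; simp only [WithLp.sub_fst, WithLp.sub_snd, map_sub]; module
  rw [e1, ← WithLp.sub_fst, ← hq] at k1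
  rw [e2, ← WithLp.sub_fst, ← WithLp.sub_snd, ← hq, real_inner_comm] at k2
  rw [e3, ← WithLp.sub_snd, ← WithLp.sub_snd, ← hq, real_inner_comm] at k3
  simp only [inner_sub_left, inner_add_left, real_inner_smul_left,
    ContinuousLinearMap.adjoint_inner_left] at k1 k2 k3
  rw [real_inner_comm q.fst q.snd.fst, real_inner_comm (K q.fst) q.snd.snd] at k1
  rw [pdForm_apply]
  linarith

/-- The fixed points of the step are the solutions of the optimality system. -/
theorem pdStep_eq_self_iff (hF : GammaZero F) (hG : GammaZero G) (hH : GammaZero H)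
    (hσ : 0 < σ) (hγ : 0 < γ) (hτ : 0 < τ) (z : PDSpace X Y) :
    pdStep F G H K σ γ τ z = z ↔ HasSubgradient G z.fst z.snd.fst ∧
      HasSubgradient F (K z.fst) z.snd.snd ∧
      HasSubgradient H z.fst (-z.snd.fst - adjoint K z.snd.snd) := by
  constructor
  · intro h
    obtain ⟨h1, h2, h3⟩ := hasSubgradient_pdStep hF hG hH hσ hγ hτ h (sub_self z).symm
    simp only [WithLp.zero_fst, WithLp.zero_snd, map_zero, smul_zero, sub_zero, zero_sub,
      zero_add] at h1 h2 h3
    exact ⟨h2, h3, h1⟩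
  · rintro ⟨h2, h3, h1⟩
    have hx : prox σ H (z.fst - σ • z.snd.fst - σ • (adjoint K) z.snd.snd) = z.fst := by
      refine HasSubgradient.prox_eq hσ ?_
      convert h1 using 1
      simp only [smul_sub, smul_smul, inv_mul_cancel₀ hσ.ne']
      module
    have hy : prox γ (fenchelConj G) (z.snd.fst + γ • ((2 : ℝ) • z.fst - z.fst)) = z.snd.fst := by
      refine HasSubgradient.prox_eq hγ ?_
      convert h2.fenchelConj using 1
      rw [add_sub_cancel_left, smul_smul, inv_mul_cancel₀ hγ.ne']
      module
    have hv : prox τ (fenchelConj F) (z.snd.snd + τ • K ((2 : ℝ) • z.fst - z.fst)) =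
        z.snd.snd := by
      refine HasSubgradient.prox_eq hτ ?_
      convert h3.fenchelConj using 1
      rw [add_sub_cancel_left, smul_smul, inv_mul_cancel₀ hτ.ne', map_sub, map_smul]
      module
    simp only [pdStep, hx, hy, hv]
    rfl

end PrimalDualStep

/-! ### Convergence of the primal iterates -/

/-- In finite dimension the coordinates in an orthonormal basis detect norm convergence. -/
theorem tendsto_of_tendsto_inner {E ι : Type*} [NormedAddCommGroup E] [InnerProductSpace ℝ E]
    [FiniteDimensional ℝ E] {l : Filter ι} {u : ι → E} {p : E}
    (h : ∀ w, Tendsto (fun i => ⟪u i, w⟫) l (𝓝 ⟪p, w⟫)) : Tendsto u l (𝓝 p) := by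
  set b := stdOrthonormalBasis ℝ E
  have h1 : Tendsto (fun i => ∑ j, ⟪u i, b j⟫ • b j) l (𝓝 (∑ j, ⟪p, b j⟫ • b j)) :=
    tendsto_finsetSum _ fun j _ => (h (b j)).smul_const (b j)
  simpa only [real_inner_comm (b _), b.sum_repr'] using h1

theorem theorem3p1
    {X Y : Type*} [NormedAddCommGroup X] [InnerProductSpace ℝ X] [CompleteSpace X]
    [NormedAddCommGroup Y] [InnerProductSpace ℝ Y] [CompleteSpace Y]
    (F : Y → EReal) (G H : X → EReal) (K : X →L[ℝ] Y)
    (hF : GammaZero F) (hG : GammaZero G) (hH : GammaZero H)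
    (hattained : ∃ x : X, IsPrimalSolution F G H K x)
    (hqual : QualificationCondition F G H K)
    (σ γ τ : ℝ) (hσ : 0 < σ) (hγ : 0 < γ) (hτ : 0 < τ)
    (hstep : σ * γ + σ * τ * ‖K‖ ^ 2 < 1)
    (α ρ : ℕ → ℝ) (αbar ρmin θ δ : ℝ)
    (hα_mono : ∀ k, 1 ≤ k → α k ≤ α (k + 1))
    (hα_one : α 1 = 0)
    (hα_bounds : ∀ k, 1 ≤ k → 0 ≤ α k ∧ α k ≤ αbar)
    (hαbar : αbar < 1)
    (hρmin : 0 < ρmin) (hθ : 0 < θ) (hδ_pos : 0 < δ)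
    (hδ : (αbar ^ 2 * (1 + αbar) + αbar * θ) / (1 - αbar ^ 2) < δ)
    (hρ : ∀ k, 1 ≤ k → ρmin ≤ ρ k ∧
      ρ k < (δ - αbar * (αbar * (1 + αbar) + αbar * δ + θ)) /
        (δ * (1 + αbar * (1 + αbar) + αbar * δ + θ)))
    (x y : ℕ → X) (v : ℕ → Y)
    (hiter : IsIPDFPSequence F G H K σ γ τ α ρ x y v) :
    ∃ xstar : X, IsPrimalSolution F G H K xstar ∧
      (∀ w : X, Tendsto (fun k => inner ℝ (x k) w) atTop (𝓝 (inner ℝ xstar w))) ∧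
      (FiniteDimensional ℝ X → Tendsto x atTop (𝓝 xstar)) := by
  obtain ⟨κ, hκ, hcoer⟩ := pdForm_coercive hσ hγ hτ hstep
  obtain ⟨x₀, hx₀⟩ := hattained
  obtain ⟨y₀, v₀, hsol⟩ := hx₀.exists_hasSubgradient hF hG hH hqual
  have hfix : ∃ p, pdStep F G H K σ γ τ p = p :=
    ⟨pdMk x₀ y₀ v₀, (pdStep_eq_self_iff hF hG hH hσ hγ hτ _).mpr hsol⟩
  -- the algorithm starts at index `1`, hence the shift of the parameters
  obtain ⟨p, hp, hweak⟩ := exists_weak_limit_inertial (pdForm_comm σ γ τ K) hκ hcoer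
    (pdStep_firmlyNonexpansive hF hG hH hσ hγ hτ) hfix
    (a := fun k => α (k + 1)) (ρ := fun k => ρ (k + 1)) (z := fun k => pdMk (x k) (y k) (v k))
    hαbar (fun k => hα_bounds _ (Nat.le_add_left 1 k)) (fun k => hα_mono _ (Nat.le_add_left 1 k))
    hα_one hρmin hθ hδ_pos (fun k => hρ _ (Nat.le_add_left 1 k)) (fun k => rfl) (fun k => by
      obtain ⟨h1, h2, h3⟩ := hiter (k + 1) (Nat.le_add_left 1 k)
      rw [h1, h2, h3]
      rfl)
  obtain ⟨hpG, hpF, hpH⟩ := (pdStep_eq_self_iff hF hG hH hσ hγ hτ p).mp hp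
  have hweak' : ∀ w : X, Tendsto (fun k => ⟪x k, w⟫) atTop (𝓝 ⟪p.fst, w⟫) := by
    intro w
    have h1 := hweak (pdMk w 0 0)
    simpa [pdMk] using h1
  exact ⟨p.fst, isPrimalSolution_of_hasSubgradient hpG hpF hpH, hweak',
    fun _ => tendsto_of_tendsto_inner hweak'⟩
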